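/- Let $X$ be a Hausdorff, path-connected, locally path-connected and semi-locally simply connected space, and let $\mathcal C(X)$ be the ring of continuous functions $X\to\mathbb C$. Let $f\in\mathcal C(X)[z]$ be a Weierstrass polynomial of degree $n$: $f$ is monic of degree $n$ and, for every $x\in X$, the complex polynomial $f_x$ has $n$ distinct roots. For a covering $p:Y\to X$ with $Y$ path-connected, a root of $p^*f$ is a continuous $\beta:Y\to\mathbb C$ with $f_{p(y)}(\beta(y))=0$ for all $y\in Y$, and $f$ splits in $Y$ if $p^*f$ has $n$ distinct roots. Let $q:E_f\to X$ be a splitting covering of $f$, that is, a path-connected covering in which $f$ splits and such that for every path-connected covering $p:Y\to X$ in which $f$ splits there is a covering map $\pi:Y\to E_f$ with $q\pi=p$. Let $e_0\in E_f$, $x_0=q(e_0)$, and let $\alpha_1,\dots,\alpha_n\in\mathcal C(E_f)$ be the $n$ distinct roots of $q^*f$. For a covering $r:Y\to Z$ let $A(Y/Z)$ be the group of homeomorphisms $\Phi:Y\to Y$ with $r\Phi=r$. Put $R=q^*\mathcal C(X)=\{\gamma\circ q:\gamma\in\mathcal C(X)\}\subset\mathcal C(E_f)$ and $G_f=\mathrm{Aut}_R(R[\alpha_1,\dots,\alpha_n])$.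 For $I=(i_1,\dots,i_n)$ with $0\le i_k\le n-k$ put $\alpha^I=\alpha_1^{i_1}\cdots\alpha_n^{i_n}$ and $\sigma^I=\sigma_1^{i_1}\cdots\sigma_n^{i_n}\in S_n$, where $\sigma_k$ is the cycle $(k\ k{+}1\ \cdots\ n)$, and let $$\Delta=\det\Bigl(\prod_{k=1}^n\alpha_{\sigma^I(k)}^{j_k}\Bigr)_{I,J}\in\mathcal C(E_f)$$ be the determinant of the $n!\times n!$ matrix with rows $I$ and columns $J=(j_1,\dots,j_n)$ running over these multi-indices in the same order (the $(I,J)$ entry is $\sigma^I$ applied to $\alpha^J$). Let $T$ be a subring of $R$ that contains the coefficients of $q^*f$, such that $T[\alpha_1,\dots,\alpha_n]\cap R=T$ and $1/\Delta\in T[\alpha_1,\dots,\alpha_n]$ (that is, $\Delta$ has an inverse in $\mathcal C(E_f)$ that lies in this subring). Write $T[\alpha]=T[\alpha_1,\dots,\alpha_n]$ and $G=\mathrm{Aut}_T(T[\alpha])$. Then: 1. $\omega(\Phi)(\beta)=\beta\circ\Phi^{-1}$ defines a group isomorphism $\omega:A(E_f/X)\to G$. 2. There are one-to-one correspondences $$(L,l_0)\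 \longleftrightarrow\ H=A(E_f/L)\ \longleftrightarrow\ H'=\omega(H)\ \longleftrightarrow\ L'=T[\alpha]^{H'}$$ between - isomorphism classes of based path-connected covering spaces between $(E_f,e_0)$ and $(X,x_0)$, that is, based coverings $(E_f,e_0)\to(L,l_0)\to(X,x_0)$ with composite $q$, up to based isomorphism over $X$, - subgroups $H$ of $A(E_f/X)$, - subgroups $H'$ of $G$, and - separable $T$-subalgebras $L'$ of $T[\alpha]$ ($L'$ is projective as an $L'\otimes_T L'$-module); the inverse of the last correspondence is $L'\mapsto G_{L'}=\{\phi\in G:\phi|_{L'}=\mathrm{id}\}$. If $(L,l_0)$, $(M,m_0)$ correspond to $H,H',L'$ and $J,J',M'$ respectively, then there is a based covering map $(L,l_0)\to(M,m_0)$ over $X$ if and only if $H\subset J$, if and only if $H'\subset J'$, if and only if $L'\supset M'$. The covering $E_f$ corresponds to the trivial subgroups and to $T[\alpha]$, and $X$ corresponds to $A(E_f/X)$, $G$ and $T$. Moreover, for every based covering map $(L,l_0)\to(M,m_0)$ over $X$ all fibres are finite, of cardinality $[L:M]=[J:H]=[J':H']$. In particular (taking $T=R$, for which no further hypothesis is needed)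 $\omega$ gives an isomorphism $A(E_f/X)\cong G_f$. -/

import Mathlib

open Polynomial TensorProduct Topology

universe u

noncomputable section

namespace SemiTopGalois

/-- Every point `x` has a neighbourhood `U` such that all loops at `x` inside `U` are
null-homotopic in `X`. -/
def SemilocallySimplyConnected (X : Type*) [TopologicalSpace X] : Prop :=
  ∀ x : X, ∃ U ∈ 𝓝 x, ∀ γ : Path x x, Set.range γ ⊆ U → γ.Homotopic (Path.refl x)

/-! ### Weierstrass polynomials, roots, splitting coverings -/

/-- The complex polynomial `f_x`, for `f ∈ C(X)[z]` and `x ∈ X`. -/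
def fiberPoly {X : Type*} [TopologicalSpace X] (f : C(X, ℂ)[X]) (x : X) : ℂ[X] :=
  f.map (ContinuousMap.evalAlgHom ℂ ℂ x : C(X, ℂ) →ₐ[ℂ] ℂ).toRingHom

/-- `f` is monic of degree `n` and each `f_x` has exactly `n` distinct roots. -/
structure IsWeierstrass {X : Type*} [TopologicalSpace X] (f : C(X, ℂ)[X]) (n : ℕ) : Prop where
  monic : f.Monic
  natDegree_eq : f.natDegree = n
  ncard_roots : ∀ x : X, {z : ℂ | (fiberPoly f x).eval z = 0}.ncard = n

/-- The pullback `q* : C(X) → C(Y)`, `γ ↦ γ ∘ q`. -/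
def pullback {X Y : Type*} [TopologicalSpace X] [TopologicalSpace Y] (q : C(Y, X)) :
    C(X, ℂ) →+* C(Y, ℂ) :=
  (ContinuousMap.compRightAlgHom ℂ ℂ q).toRingHom

/-- A root of `f` on `X`: a continuous function `β` with `f_x(β(x)) = 0` for all `x`. -/
def IsFunRoot {X : Type*} [TopologicalSpace X] (f : C(X, ℂ)[X]) (β : C(X, ℂ)) : Prop :=
  ∀ x : X, (fiberPoly f x).eval (β x) = 0

/-- `α` lists `n` distinct roots of `q* f` on `Y`. -/
structure IsRootList {X Y : Type*} [TopologicalSpace X] [TopologicalSpace Y] (q : C(Y, X))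
    (f : C(X, ℂ)[X]) {n : ℕ} (α : Fin n → C(Y, ℂ)) : Prop where
  injective : Function.Injective α
  isFunRoot : ∀ i, IsFunRoot (f.map (pullback q)) (α i)

/-- `f` (of degree `n`) splits in `Y` (along `q : Y → X`). -/
def SplitsIn {X Y : Type*} [TopologicalSpace X] [TopologicalSpace Y] (q : C(Y, X))
    (f : C(X, ℂ)[X]) (n : ℕ) : Prop :=
  ∃ α : Fin n → C(Y, ℂ), IsRootList q f α

/-- `q : E → X` is a splitting covering of `f`: a path-connected covering in which `f` splits and
which is covered, over `X`, by every other path-connected covering in which `f` splits. -/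
structure IsSplittingCovering {X E : Type u} [TopologicalSpace X] [TopologicalSpace E]
    (q : C(E, X)) (f : C(X, ℂ)[X]) (n : ℕ) : Prop where
  isCoveringMap : IsCoveringMap q
  pathConnected : PathConnectedSpace E
  splits : SplitsIn q f n
  minimal : ∀ (Y : Type u) [TopologicalSpace Y] [PathConnectedSpace Y] (p : C(Y, X)),
    IsCoveringMap p → SplitsIn p f n → ∃ π : C(Y, E), IsCoveringMap π ∧ q.comp π = p

/-! ### Covering transformations -/

/-- The group `A(Y/X)` of covering transformations of `q : Y → X`. -/
def deck {X Y : Type*} [TopologicalSpace X] [TopologicalSpace Y] (q : C(Y, X)) :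
    Subgroup (Y ≃ₜ Y) where
  carrier := {Φ | ∀ y, q (Φ y) = q y}
  mul_mem' {a b} ha hb y := (ha (b y)).trans (hb y)
  one_mem' _ := rfl
  inv_mem' {a} ha y := by
    have h := ha (a.symm y)
    rw [a.apply_symm_apply] at h
    exact h.symm

theorem isCoveringMap_id (X : Type*) [TopologicalSpace X] :
    IsCoveringMap (ContinuousMap.id X) := fun _ =>
  IsEvenlyCovered.to_isEvenlyCovered_preimage (I := PUnit.{1})
    ⟨inferInstance, Set.univ, trivial, isOpen_univ, isOpen_univ,
      (Homeomorph.prodPUnit (Set.univ : Set X)).symm, fun _ => rfl⟩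

/-- A based covering space `(L, l₀)` between `(E, e₀)` and `X`:
based coverings `(E, e₀) → (L, l₀) → (X, q e₀)` with composite `q` and `L` path-connected. -/
structure IntermediateCovering {X E : Type u} [TopologicalSpace X] [TopologicalSpace E]
    (q : C(E, X)) (e₀ : E) where
  carrier : Type u
  [top : TopologicalSpace carrier]
  [pathConnected : PathConnectedSpace carrier]
  point : carrier
  fromTop : C(E, carrier)
  toBase : C(carrier, X)
  isCoveringMap_fromTop : IsCoveringMap fromTop
  isCoveringMap_toBase : IsCoveringMap toBase
  comp_eq : toBase.comp fromTop = q
  map_point : fromTop e₀ = point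

attribute [instance] IntermediateCovering.top IntermediateCovering.pathConnected

namespace IntermediateCovering

variable {X E : Type u} [TopologicalSpace X] [TopologicalSpace E] {q : C(E, X)} {e₀ : E}

/-- `s : (L, l₀) → (M, m₀)` is a based covering map over `X`. -/
structure IsCoveringOver (L M : IntermediateCovering q e₀) (s : C(L.carrier, M.carrier)) :
    Prop where
  isCoveringMap : IsCoveringMap s
  comp_eq : M.toBase.comp s = L.toBase
  map_point : s L.point = M.point

/-- Isomorphism of based covering spaces of `X`. -/
def Iso (L M : IntermediateCovering q e₀) : Prop :=
  ∃ h : L.carrier ≃ₜ M.carrier, (∀ l, M.toBase (h l) = L.toBase l) ∧ h L.point = M.point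

variable (q e₀) in
/-- Isomorphism of intermediate coverings, as an equivalence relation. -/
def isoSetoid : Setoid (IntermediateCovering q e₀) where
  r := Iso
  iseqv :=
    { refl := fun L => ⟨Homeomorph.refl _, fun _ => rfl, rfl⟩
      symm := by
        rintro L M ⟨h, h₁, h₂⟩
        refine ⟨h.symm, fun m => ?_, ?_⟩
        · rw [← h₁, h.apply_symm_apply]
        · rw [← h₂, h.symm_apply_apply]
      trans := by
        rintro L M N ⟨h, h₁, h₂⟩ ⟨k, k₁, k₂⟩
        refine ⟨h.trans k, fun l => ?_, ?_⟩
        · rw [Homeomorph.trans_apply, k₁, h₁]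
        · rw [Homeomorph.trans_apply, h₂, k₂] }

/-- The subgroup `A(E/L)` of `A(E/X)`. -/
def deckOver (L : IntermediateCovering q e₀) : Subgroup (deck q) :=
  (deck L.fromTop).subgroupOf (deck q)

variable (e₀) in
/-- `E` itself as an intermediate covering. -/
def self (hE : PathConnectedSpace E) (hq : IsCoveringMap q) : IntermediateCovering q e₀ where
  carrier := E
  point := e₀
  fromTop := ContinuousMap.id E
  toBase := q
  isCoveringMap_fromTop := isCoveringMap_id E
  isCoveringMap_toBase := hq
  comp_eq := by ext; rfl
  map_point := rfl

variable (e₀) in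
/-- `X` itself as an intermediate covering. -/
def base [PathConnectedSpace X] (hq : IsCoveringMap q) : IntermediateCovering q e₀ where
  carrier := X
  point := q e₀
  fromTop := q
  toBase := ContinuousMap.id X
  isCoveringMap_fromTop := hq
  isCoveringMap_toBase := isCoveringMap_id X
  comp_eq := by ext; rfl
  map_point := rfl

end IntermediateCovering

/-! ### The function `Δ` -/

/-- The set of multi-indices `(i₁, …, iₙ)` with `0 ≤ i_k ≤ n - k`. With indices starting from `0`
the `k`-th entry is `< n - k`; the last entry is always zero. -/
abbrev MultiIndex (n : ℕ) : Type := (k : Fin n) → Fin (n - k)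

/-- The cycle `σ_k = (k  k+1  …  n)`. -/
def cyc {n : ℕ} (k : Fin n) : Equiv.Perm (Fin n) :=
  Fin.cycleIcc k ⟨n - 1, Nat.sub_one_lt_of_lt k.2⟩

/-- `σ^I = σ₁^{i₁} σ₂^{i₂} ⋯ σₙ^{iₙ}`. -/
def sigmaPow {n : ℕ} (I : MultiIndex n) : Equiv.Perm (Fin n) :=
  (List.ofFn fun k => cyc k ^ (I k : ℕ)).prod

/-- The matrix `(φ_I(x_J))` with `x_J = α^J` and `φ_I = σ^I` acting by permuting the `α`'s. -/
def vMatrix {A : Type*} [CommRing A] {n : ℕ} (α : Fin n → A) :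
    Matrix (MultiIndex n) (MultiIndex n) A :=
  Matrix.of fun I J => ∏ k, α (sigmaPow I k) ^ (J k : ℕ)

/-- `Δ = det (φ_I(x_J))`. -/
def Delta {A : Type*} [CommRing A] {n : ℕ} (α : Fin n → A) : A :=
  (vMatrix α).det

/-! ### Rings -/

/-- `S` is a separable `R`-algebra: `S` is projective as a module over `S ⊗_R S`
(acting through multiplication). -/
def IsSeparableAlgebra (R S : Type*) [CommRing R] [CommRing S] [Algebra R S] : Prop :=
  letI : Module (S ⊗[R] S) S :=
    Module.compHom S (Algebra.TensorProduct.lmul' R : S ⊗[R] S →ₐ[R] S).toRingHom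
  Module.Projective (S ⊗[R] S) S

/-- The separable `R`-subalgebras of `S`, ordered by inclusion. -/
abbrev SepSubalgebra (R S : Type*) [CommRing R] [CommRing S] [Algebra R S] : Type _ :=
  {L : Subalgebra R S // IsSeparableAlgebra R L}

/-- `T[α₁, …, αₙ]`. -/
abbrev adjoinRoots {A : Type*} [CommRing A] (T : Subring A) {n : ℕ} (α : Fin n → A) :
    Subalgebra T A :=
  Algebra.adjoin T (Set.range α)

/-- `Aut_T T[α₁, …, αₙ]`. -/
abbrev autGroup {A : Type*} [CommRing A] (T : Subring A) {n : ℕ} (α : Fin n → A) : Type _ :=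
  adjoinRoots T α ≃ₐ[T] adjoinRoots T α

/-- The isomorphism `ω : A(E/X) ≃ Aut_T T[α]` acts by `ω(Φ)(β) = β ∘ Φ⁻¹`. -/
def IsOmega {X E : Type*} [TopologicalSpace X] [TopologicalSpace E] (q : C(E, X))
    (T : Subring C(E, ℂ)) {n : ℕ} (α : Fin n → C(E, ℂ)) (ω : deck q ≃* autGroup T α) : Prop :=
  ∀ (Φ : deck q) (β : adjoinRoots T α) (y : E),
    (ω Φ β : C(E, ℂ)) y = (β : C(E, ℂ)) ((Φ : E ≃ₜ E).symm y)

end SemiTopGalois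

end

open SemiTopGalois

/-! Two Galois correspondences, one topological and one algebraic, are glued along ω.

Topology. An ordering of the roots of `q^* f` maps `E_f` to the covering of `X` whose fibre over `x`
is the set of orderings of the roots of `f_x`. Minimality identifies `E_f` with a component of that
covering (`finite_and_homeomorph`). So `q` has finite fibres, and reordering the roots carries any
point of a fibre to any other: `E_f` is a finite regular covering. The intermediate coverings are
then the quotients `E_f/H`. Since everything is Hausdorff and `q` is proper, the required maps are
recognised as coverings because they are proper local homeomorphisms
(`IsCoveringMap.of_comp_of_finite`).

Algebra. For `S = T[α]` one has `S^G = T`, and invertibility of Δ makes differences of distinct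
roots units (`isUnit_sub_of_isUnit_Delta`), which yields Galois coordinates. Through `x ⊗ y ↦ (x * g
y)_g` they embed `S ⊗_T S` in the ring of functions `G → S`. There the separability idempotent of
`S^H` is the indicator function of `H`. Conversely, the idempotent of a separable subalgebra takes
only the values 0 and 1, because `E_f` is connected, and its support is the group fixing the
subalgebra.

The bridge ω. It is injective because the roots separate the points of a fibre. For surjectivity,
compare `β ↦ β(e)` with `β ↦ φ(β)(e)`: these homomorphisms to ℂ agree on `T`, hence on the roots
they differ by a covering transformation (`exists_forall_eq_of_eq_on_invariants`), and root
functions that agree at one point are equal. This half does not involve Δ, whence the unconditional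
case `T = R`. -/

/-! ### Galois coordinates -/

section GaloisCoordinates

variable {S G : Type*} [CommRing S] [Group G] [MulSemiringAction G S]

/-- A finite family of pairs `(x, y)` with `∑ x * g y = δ_{g, 1}` for all `g ∈ G`. -/
structure IsGaloisCoordinates (G : Type*) [Group G] [MulSemiringAction G S]
    (B : Finset (S × S)) : Prop where
  sum_mul : ∑ p ∈ B, p.1 * p.2 = 1
  sum_mul_smul : ∀ g : G, g ≠ 1 → ∑ p ∈ B, p.1 * g • p.2 = 0

theorem IsGaloisCoordinates.subgroup {B : Finset (S × S)} (hB : IsGaloisCoordinates G B)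
    (H : Subgroup G) : IsGaloisCoordinates H B where
  sum_mul := hB.sum_mul
  sum_mul_smul g hg := hB.sum_mul_smul g (by simpa using hg)

/-- The map `x ⊗ y ↦ x * g y`. -/
noncomputable def twistedMul (T : Type*) [CommRing T] [Algebra T S] [SMulCommClass G T S] (g : G) :
    S ⊗[T] S →ₐ[T] S :=
  Algebra.TensorProduct.lift (AlgHom.id T S) (MulSemiringAction.toAlgHom T S g)
    fun _ _ => Commute.all _ _

@[simp]
theorem twistedMul_tmul {T : Type*} [CommRing T] [Algebra T S] [SMulCommClass G T S] (g : G)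
    (x y : S) : twistedMul T g (x ⊗ₜ[T] y) = x * g • y := by
  simp [twistedMul]

/-- If `u (s - g s) = 1`, the tensor `u ⊗ s - u (g s) ⊗ 1` is sent to 1 by the multiplication and to
0 by its twist by `g`. The twisted multiplications are ring homomorphisms, so the product of these
tensors over all `g` serves every `g` at once. Tensors over ℤ suffice, as only the sums matter. -/
theorem exists_isGaloisCoordinates [Finite G]
    (h : ∀ g : G, g ≠ 1 → ∃ s : S, IsUnit (s - g • s)) :
    ∃ B : Finset (S × S), IsGaloisCoordinates G B := by
  classical
  have := Fintype.ofFinite G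
  have h' (g : G) : ∃ e : S ⊗[ℤ] S, twistedMul ℤ (1 : G) e = 1 ∧
      (g ≠ 1 → twistedMul ℤ g e = 0) := by
    by_cases hg : g = 1
    · exact ⟨1, by simp, fun h => (h hg).elim⟩
    · obtain ⟨s, hs⟩ := h g hg
      obtain ⟨u, hu⟩ := hs.exists_right_inv
      refine ⟨u ⊗ₜ s - (u * g • s) ⊗ₜ 1, ?_, fun _ => ?_⟩
      · simp only [map_sub, twistedMul_tmul, one_smul]
        linear_combination hu
      · simp
  choose e he he' using h'
  obtain ⟨B, hB⟩ := TensorProduct.exists_finset (∏ g, e g)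
  have key (g : G) : ∑ p ∈ B, p.1 * g • p.2 = ∏ k, twistedMul ℤ g (e k) := by
    rw [← map_prod, hB, map_sum]
    simp
  refine ⟨B, ?_, fun g hg => ?_⟩
  · simpa [he] using key 1
  · rw [key]
    exact Finset.prod_eq_zero (Finset.mem_univ g) (he' g hg)

namespace IsGaloisCoordinates

variable {B : Finset (S × S)}

/-- A dual basis formula: the `x` together with the functionals `s ↦ Tr(y s)` reconstruct `s`. After
exchanging the sums only the term `g = 1` survives. -/
theorem sum_mul_sum_smul [Fintype G] (hB : IsGaloisCoordinates G B) (s : S) :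
    ∑ p ∈ B, p.1 * ∑ g : G, g • (p.2 * s) = s := by
  simp_rw [Finset.mul_sum, smul_mul']
  rw [Finset.sum_comm, Finset.sum_eq_single 1]
  · simp_rw [one_smul, ← mul_assoc, ← Finset.sum_mul, hB.sum_mul, one_mul]
  · intro g _ hg
    simp_rw [← mul_assoc, ← Finset.sum_mul, hB.sum_mul_smul g hg, zero_mul]
  · simp

/-- The traces form an ideal `I` of the invariant ring. The dual basis formula at `s = 1` shows that
`I` generates the unit ideal of `S`; as `S` is integral over the invariants, `I` is already the unit
ideal. -/
theorem exists_sum_smul_eq_one [Fintype G] (hB : IsGaloisCoordinates G B) :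
    ∃ c : S, ∑ g : G, g • c = 1 := by
  let F := FixedPoints.subring S G
  have hF (s : S) : ∑ g : G, g • s ∈ F := by
    intro k
    rw [Finset.smul_sum]
    simp_rw [← mul_smul]
    exact Fintype.sum_equiv (Equiv.mulLeft k) _ _ fun _ => rfl
  have hinv : Algebra.IsInvariant F S G := ⟨fun b hb => ⟨⟨b, hb⟩, rfl⟩⟩
  let I : Ideal F :=
    { carrier := {t | ∃ c : S, ∑ g : G, g • c = t}
      add_mem' := by
        rintro _ _ ⟨c, hc⟩ ⟨d, hd⟩
        exact ⟨c + d, by simp [smul_add, Finset.sum_add_distrib, hc, hd]⟩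
      zero_mem' := ⟨0, by simp⟩
      smul_mem' := by
        rintro t _ ⟨c, hc⟩
        refine ⟨t * c, ?_⟩
        have ht (g : G) : g • (t : S) = t := t.2 g
        simp [smul_mul', ht, ← Finset.mul_sum, hc] }
  suffices hI : I = ⊤ by
    obtain ⟨c, hc⟩ := (hI ▸ Submodule.mem_top : (1 : F) ∈ I)
    exact ⟨c, hc⟩
  have hint : (algebraMap F S).IsIntegral :=
    (Algebra.IsInvariant.isIntegral F S G).isIntegral
  refine (Ideal.map_eq_top_iff_of_ker_le (algebraMap F S) ?_ hint).1 ?_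
  · intro t ht
    have : t = 0 := Subtype.ext (by simpa using ht)
    simp [this]
  · rw [Ideal.eq_top_iff_one]
    have h1 : (1 : S) = _ := (hB.sum_mul_sum_smul 1).symm
    rw [h1]
    refine Ideal.sum_mem _ fun p _ => Ideal.mul_mem_left _ _ ?_
    exact Ideal.mem_map_of_mem (I := I) (algebraMap F S) (x := ⟨_, hF (p.2 * 1)⟩) ⟨p.2 * 1, rfl⟩

end IsGaloisCoordinates

end GaloisCoordinates

/-! ### Separability idempotents -/

/-- Projectivity amounts to a splitting of the multiplication `S ⊗ S → S`, and a splitting is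
determined by the image `e` of 1. -/
theorem isSeparableAlgebra_iff {R S : Type*} [CommRing R] [CommRing S] [Algebra R S] :
    IsSeparableAlgebra R S ↔ ∃ e : S ⊗[R] S, Algebra.TensorProduct.lmul' R e = 1 ∧
      ∀ s : S, (s ⊗ₜ[R] (1 : S)) * e = ((1 : S) ⊗ₜ[R] s) * e := by
  let φ := (Algebra.TensorProduct.lmul' R : S ⊗[R] S →ₐ[R] S)
  let : Module (S ⊗[R] S) S := Module.compHom S φ.toRingHom
  have hsmul (w : S ⊗[R] S) (s : S) : w • s = φ w * s := rfl
  let μ : S ⊗[R] S →ₗ[S ⊗[R] S] S :=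
    { toFun := φ
      map_add' := map_add φ
      map_smul' := fun w v => by simp [hsmul] }
  have hμ : Function.Surjective μ := fun s => ⟨s ⊗ₜ 1, by simp [μ, φ]⟩
  change Module.Projective (S ⊗[R] S) S ↔ _
  constructor
  · intro hproj
    obtain ⟨σ, hσ⟩ := Module.projective_lifting_property μ LinearMap.id hμ
    refine ⟨σ 1, DFunLike.congr_fun hσ 1, fun s => ?_⟩
    rw [← smul_eq_mul, ← smul_eq_mul, ← map_smul, ← map_smul, hsmul, hsmul]
    simp [φ]
  · rintro ⟨e, he, hs⟩
    -- Multiplying `e` by `w` depends only on the product `φ w`; this makes `s ↦ (s ⊗ 1) e` linear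
    -- over `S ⊗ S`.
    have hw (w : S ⊗[R] S) : w * e = (φ w ⊗ₜ 1) * e := by
      induction w with
      | zero => simp
      | tmul a b =>
        have : a ⊗ₜ[R] b = (a ⊗ₜ[R] (1 : S)) * ((1 : S) ⊗ₜ[R] b) := by simp
        rw [this, mul_assoc, ← hs, ← mul_assoc]
        simp [φ]
      | add x y hx hy => simp [add_mul, hx, hy, TensorProduct.add_tmul]
    let σ : S →ₗ[S ⊗[R] S] S ⊗[R] S :=
      { toFun := fun s => (s ⊗ₜ 1) * e
        map_add' := fun a b => by simp [TensorProduct.add_tmul, add_mul]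
        map_smul' := fun w s => by
          have : (φ w * s) ⊗ₜ[R] (1 : S) = (s ⊗ₜ 1) * (φ w ⊗ₜ 1) := by
            simp [mul_comm]
          simp only [hsmul, this, RingHom.id_apply, smul_eq_mul]
          rw [mul_assoc, ← hw]
          ring }
    refine Module.Projective.of_split σ μ (LinearMap.ext fun s => ?_)
    change φ ((s ⊗ₜ 1) * e) = s
    rw [map_mul, he]
    simp [φ]

/-! ### The Galois correspondence for a Galois extension of rings -/

section GaloisCorrespondence

variable {T S G : Type*} [CommRing T] [CommRing S] [Algebra T S] [Group G] [MulSemiringAction G S]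
  [SMulCommClass G T S] {B : Finset (S × S)}

/-- The trace `s ↦ ∑ g s` of a finite group. -/
noncomputable def groupTrace (T S G : Type*) [CommRing T] [CommRing S] [Algebra T S] [Group G]
    [MulSemiringAction G S] [SMulCommClass G T S] [Fintype G] :
    S →ₗ[T] FixedPoints.subalgebra T S G :=
  LinearMap.codRestrict (Subalgebra.toSubmodule (FixedPoints.subalgebra T S G))
    (∑ g : G, (MulSemiringAction.toAlgHom T S g).toLinearMap) fun s k => by
      simp only [LinearMap.coe_sum, Finset.sum_apply, AlgHom.toLinearMap_apply,
        MulSemiringAction.toAlgHom_apply, Finset.smul_sum, ← mul_smul]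
      exact Fintype.sum_equiv (Equiv.mulLeft k) _ _ fun _ => rfl

@[simp]
theorem coe_groupTrace [Fintype G] (s : S) : (groupTrace T S G s : S) = ∑ g : G, g • s := by
  change (∑ g : G, (MulSemiringAction.toAlgHom T S g).toLinearMap) s = _
  simp

theorem groupTrace_mul [Fintype G] (a : FixedPoints.subalgebra T S G) (s : S) :
    groupTrace T S G (a * s) = a * groupTrace T S G s := by
  ext
  have ha (g : G) : g • (a : S) = a := a.2 g
  simp [smul_mul', ha, Finset.mul_sum]

namespace IsGaloisCoordinates

/-- The elements of `S ⊗ S` are detected by the maps `x ⊗ y ↦ x * g y`. -/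
theorem eq_of_twistedMul_eq [Finite G] [Algebra.IsInvariant T S G] (hB : IsGaloisCoordinates G B)
    {v w : S ⊗[T] S} (h : ∀ g : G, twistedMul T g v = twistedMul T g w) : v = w := by
  have := Fintype.ofFinite G
  -- An inversion formula recovering `w` from its twisted products. On `a ⊗ b` the bracket is `Tr(y
  -- b) • a`; the trace lies in `T`, crosses the tensor sign, and the dual basis formula applies.
  have key (w : S ⊗[T] S) :
      ∑ p ∈ B, (∑ g : G, g • p.2 * twistedMul T g w) ⊗ₜ[T] p.1 = w := by
    induction w with
    | zero => simp
    | add x y hx hy =>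
      simp only [map_add, mul_add, Finset.sum_add_distrib, TensorProduct.add_tmul, hx, hy]
    | tmul a b =>
      have ht (s : S) : ∃ t : T, algebraMap T S t = ∑ g : G, g • s :=
        Algebra.IsInvariant.isInvariant (G := G) _ (groupTrace T S G s).2.out
          |>.imp fun t ht => by simpa using ht
      choose t ht using ht
      have h1 (p : S × S) : (∑ g : G, g • p.2 * twistedMul T g (a ⊗ₜ[T] b)) ⊗ₜ[T] p.1 =
          a ⊗ₜ[T] (p.1 * ∑ g : G, g • (p.2 * b)) := by
        have : ∑ g : G, g • p.2 * twistedMul T g (a ⊗ₜ[T] b) = t (p.2 * b) • a := by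
          rw [Algebra.smul_def, ht, Finset.sum_mul]
          refine Finset.sum_congr rfl fun g _ => ?_
          rw [twistedMul_tmul, smul_mul']
          ring
        rw [this, TensorProduct.smul_tmul, Algebra.smul_def, ht, mul_comm]
      simp_rw [h1]
      rw [← TensorProduct.tmul_sum, hB.sum_mul_sum_smul]
  rw [← key v, ← key w]
  simp_rw [h]

/-- The element `∑ x ⊗ y` of `S ⊗ S`. -/
noncomputable def toTensor (T : Type*) [CommRing T] [Algebra T S] (B : Finset (S × S)) :
    S ⊗[T] S := ∑ p ∈ B, p.1 ⊗ₜ p.2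

theorem twistedMul_toTensor (hB : IsGaloisCoordinates G B) [DecidableEq G] (g : G) :
    twistedMul T g (toTensor T B) = if g = 1 then 1 else 0 := by
  have : twistedMul T g (toTensor T B) = ∑ p ∈ B, p.1 * g • p.2 := by
    simp [toTensor]
  rw [this]
  split_ifs with hg
  · simpa [hg] using hB.sum_mul
  · exact hB.sum_mul_smul g hg

theorem tmul_one_mul_toTensor [Finite G] [Algebra.IsInvariant T S G]
    (hB : IsGaloisCoordinates G B) (s : S) :
    (s ⊗ₜ[T] (1 : S)) * toTensor T B = ((1 : S) ⊗ₜ[T] s) * toTensor T B := by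
  classical
  refine hB.eq_of_twistedMul_eq (G := G) fun g => ?_
  rw [map_mul, map_mul, hB.twistedMul_toTensor]
  split_ifs with hg
  · simp [hg]
  · simp

/-- A separability element of the ring of `H`-invariants. -/
theorem exists_separability_fixedPoints [Finite G] [Algebra.IsInvariant T S G]
    (hB : IsGaloisCoordinates G B) (H : Subgroup G) [DecidablePred (· ∈ H)] :
    ∃ e : FixedPoints.subalgebra T S H ⊗[T] FixedPoints.subalgebra T S H,
      (∀ g : G, twistedMul T g (TensorProduct.map (FixedPoints.subalgebra T S H).val.toLinearMap
        (FixedPoints.subalgebra T S H).val.toLinearMap e) = if g ∈ H then 1 else 0) ∧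
      ∀ s : FixedPoints.subalgebra T S H,
        (s ⊗ₜ[T] (1 : FixedPoints.subalgebra T S H)) * e =
          ((1 : FixedPoints.subalgebra T S H) ⊗ₜ[T] s) * e := by
  classical
  have := Fintype.ofFinite G
  obtain ⟨c, hc⟩ := (hB.subgroup H).exists_sum_smul_eq_one
  let τ := groupTrace T S H
  -- Averaging both factors over `H`, weighted by `c` of `H`-trace 1, pushes the Galois tensor into
  -- `S^H ⊗ S^H`. In its `g`-component only pairs with `h⁻¹ g k = 1` contribute: there are none if
  -- `g ∉ H`, and otherwise one `k` for each `h`, with total `∑ h c = 1`.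
  let ψ := TensorProduct.map (τ ∘ₗ LinearMap.mulLeft T c) τ
  refine ⟨ψ (toTensor T B), fun g => ?_, fun s => ?_⟩
  · have key (w : S ⊗[T] S) :
        twistedMul T g (TensorProduct.map (FixedPoints.subalgebra T S H).val.toLinearMap
          (FixedPoints.subalgebra T S H).val.toLinearMap (ψ w)) =
        ∑ h : H, ∑ k : H, h • (c * twistedMul T ((h : G)⁻¹ * g * k) w) := by
      induction w with
      | zero => simp
      | add x y hx hy => simp only [map_add, hx, hy, mul_add, smul_add, Finset.sum_add_distrib]
      | tmul a b =>
        simp only [ψ, τ, TensorProduct.map_tmul, LinearMap.comp_apply, LinearMap.mulLeft_apply,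
          AlgHom.toLinearMap_apply, Subalgebra.coe_val, twistedMul_tmul, coe_groupTrace,
          Finset.smul_sum, Finset.sum_mul_sum]
        refine Finset.sum_congr rfl fun h _ => Finset.sum_congr rfl fun k _ => ?_
        simp only [smul_mul', Subgroup.smul_def, ← mul_smul]
        simp [mul_assoc]
    rw [key]
    simp_rw [hB.twistedMul_toTensor]
    split_ifs with hg
    · refine Eq.trans ?_ hc
      refine Finset.sum_congr rfl fun h _ => ?_
      rw [Finset.sum_eq_single ⟨g⁻¹ * h, H.mul_mem (H.inv_mem hg) h.2⟩]
      · simp [mul_assoc]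
      · intro k _ hk
        rw [if_neg, mul_zero, smul_zero]
        intro hk'
        refine hk (Subtype.ext ?_)
        have : (h : G) = g * k := by simpa [mul_assoc, inv_mul_eq_one] using hk'
        simp [this]
      · simp
    · refine Finset.sum_eq_zero fun h _ => Finset.sum_eq_zero fun k _ => ?_
      rw [if_neg, mul_zero, smul_zero]
      intro hk
      refine hg ?_
      have : g = h * (k : G)⁻¹ := by
        rw [eq_mul_inv_iff_mul_eq, ← inv_mul_eq_one, inv_mul_eq_one]
        rw [mul_assoc, inv_mul_eq_one] at hk
        exact hk.symm
      rw [this]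
      exact H.mul_mem h.2 (H.inv_mem k.2)
  -- Both traces are linear over `S^H`, so ψ transports the commutation relation of the Galois
  -- tensor.
  · have h1 (w : S ⊗[T] S) : ψ (((s : S) ⊗ₜ[T] (1 : S)) * w) =
        (s ⊗ₜ[T] (1 : FixedPoints.subalgebra T S H)) * ψ w := by
      induction w with
      | zero => simp
      | add x y hx hy => simp only [map_add, hx, hy, mul_add]
      | tmul a b =>
        simp [ψ, τ, mul_left_comm c, groupTrace_mul]
    have h2 (w : S ⊗[T] S) : ψ (((1 : S) ⊗ₜ[T] (s : S)) * w) =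
        ((1 : FixedPoints.subalgebra T S H) ⊗ₜ[T] s) * ψ w := by
      induction w with
      | zero => simp
      | add x y hx hy => simp only [map_add, hx, hy, mul_add]
      | tmul a b => simp [ψ, τ, groupTrace_mul]
    rw [← h1, ← h2, hB.tmul_one_mul_toTensor]

/-- A twist by `g` is invisible on `L ⊗ L` when `g` fixes `L`. This turns questions about the fixing
subgroup into evaluations of a separability element. -/
theorem lmul'_eq_twistedMul (L : Subalgebra T S) (e : L ⊗[T] L) (g : G)
    (hg : ∀ x ∈ L, g • x = x) :
    twistedMul T g (TensorProduct.map L.val.toLinearMap L.val.toLinearMap e) =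
      (Algebra.TensorProduct.lmul' T e : L) := by
  induction e with
  | zero => simp
  | add x y hx hy => simp only [map_add, hx, hy, Subalgebra.coe_add]
  | tmul a b => simp [hg b b.2]

theorem isSeparableAlgebra_fixedPoints [Finite G] [Algebra.IsInvariant T S G]
    (hB : IsGaloisCoordinates G B) (H : Subgroup G) :
    IsSeparableAlgebra T (FixedPoints.subalgebra T S H) := by
  classical
  obtain ⟨e, he, hs⟩ := hB.exists_separability_fixedPoints (T := T) H
  refine isSeparableAlgebra_iff.2 ⟨e, Subtype.ext ?_, hs⟩
  rw [← lmul'_eq_twistedMul _ e (1 : G) (by simp), he]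
  simp [H.one_mem]

/-- If `g` fixes `S^H`, then the indicator of `H` takes the same value at `g` as at 1, and `0 ≠ 1`
forces `g ∈ H`. -/
theorem fixingSubgroup_fixedPoints [Finite G] [Algebra.IsInvariant T S G] [Nontrivial S]
    (hB : IsGaloisCoordinates G B) (H : Subgroup G) :
    fixingSubgroup G (FixedPoints.subalgebra T S H : Set S) = H := by
  classical
  ext g
  rw [mem_fixingSubgroup_iff]
  refine ⟨fun hg => ?_, fun hg s hs => hs ⟨g, hg⟩⟩
  obtain ⟨e, he, -⟩ := hB.exists_separability_fixedPoints (T := T) H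
  have h1 := lmul'_eq_twistedMul _ e g hg
  rw [← lmul'_eq_twistedMul _ e (1 : G) (by simp), he, he, if_pos H.one_mem] at h1
  by_contra hgH
  simp [hgH] at h1

/-- The relation `(x ⊗ 1) e = (1 ⊗ x) e` gives `x ε = (g x) ε` for the `g`-component ε of `e`. Hence
ε is idempotent, so 0 or 1, and the value 1 forces `g` to fix `L`: the components of `e` form the
indicator of `H`. -/
theorem fixedPoints_fixingSubgroup [Finite G] [Algebra.IsInvariant T S G]
    (hS : ∀ s : S, s * s = s → s = 0 ∨ s = 1) (hB : IsGaloisCoordinates G B)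
    {L : Subalgebra T S} (hL : IsSeparableAlgebra T L) :
    FixedPoints.subalgebra T S (fixingSubgroup G (L : Set S)) = L := by
  classical
  have := Fintype.ofFinite G
  refine le_antisymm (fun s hs => ?_) fun s hs g => (mem_fixingSubgroup_iff G).1 g.2 s hs
  set H := fixingSubgroup G (L : Set S)
  obtain ⟨e, he1, he⟩ := isSeparableAlgebra_iff.1 hL
  let ι := TensorProduct.map L.val.toLinearMap L.val.toLinearMap
  have hmul (v w : L ⊗[T] L) : ι (v * w) = ι v * ι w :=
    map_mul (Algebra.TensorProduct.map L.val L.val) v w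
  have hμ (g : G) (x : L) : (x : S) * twistedMul T g (ι e) = g • (x : S) * twistedMul T g (ι e) := by
    have := congrArg (fun w => twistedMul T g (ι w)) (he x)
    simpa [hmul, ι] using this
  have hone (g : G) (hg : g ∈ H) : twistedMul T g (ι e) = 1 := by
    rw [lmul'_eq_twistedMul L e g ((mem_fixingSubgroup_iff G).1 hg), he1, Subalgebra.coe_one]
  have hidem (g : G) : twistedMul T g (ι e) * twistedMul T g (ι e) = twistedMul T g (ι e) := by
    have h1 (w : L ⊗[T] L) : twistedMul T g (ι w) * twistedMul T g (ι e) =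
        (Algebra.TensorProduct.lmul' T w : L) * twistedMul T g (ι e) := by
      induction w with
      | zero => simp
      | add x y hx hy => simp only [map_add, add_mul, hx, hy, Subalgebra.coe_add]
      | tmul a b =>
        simp only [ι, TensorProduct.map_tmul, AlgHom.toLinearMap_apply, Subalgebra.coe_val,
          twistedMul_tmul, Algebra.TensorProduct.lmul'_apply_tmul, Subalgebra.coe_mul]
        rw [mul_assoc, mul_assoc]
        exact congrArg _ (hμ g b).symm
    rw [h1, he1, Subalgebra.coe_one, one_mul]
  have hzero (g : G) (hg : g ∉ H) : twistedMul T g (ι e) = 0 := by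
    refine (hS _ (hidem g)).resolve_right fun h1 => hg ?_
    refine (mem_fixingSubgroup_iff G).2 fun x hx => ?_
    simpa [h1] using (hμ g ⟨x, hx⟩).symm
  obtain ⟨c, hc⟩ := (hB.subgroup H).exists_sum_smul_eq_one
  obtain ⟨C, hC⟩ := TensorProduct.exists_finset e
  have hCs (g : G) : twistedMul T g (ι e) = ∑ p ∈ C, (p.1 : S) * g • (p.2 : S) := by
    simp [hC, ι]
  -- With `c` of `H`-trace 1, this writes the `H`-invariant `s` as a combination of elements of `L`
  -- with `G`-traces as coefficients; these lie in `T`, so `s ∈ L`.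
  have key : ∑ p ∈ C, (p.1 : S) * ∑ g : G, g • ((p.2 : S) * (c * s)) = s := by
    simp_rw [Finset.mul_sum, smul_mul' _ (_ : S) (c * s)]
    rw [Finset.sum_comm]
    simp_rw [← mul_assoc, ← Finset.sum_mul, ← hCs]
    rw [← Finset.sum_filter_add_sum_filter_not Finset.univ (· ∈ H)]
    rw [Finset.sum_eq_zero (s := Finset.univ.filter (· ∉ H)), add_zero]
    · rw [Finset.sum_subtype (p := (· ∈ H)) _ (by simp)]
      calc ∑ h : H, twistedMul T (h : G) (ι e) * (h : G) • (c * s) = ∑ h : H, h • c * s := by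
            refine Finset.sum_congr rfl fun h _ => ?_
            rw [hone _ h.2, one_mul, smul_mul']
            exact congrArg _ (hs h)
        _ = s := by rw [← Finset.sum_mul, hc, one_mul]
    · intro g hg
      rw [hzero g (by simpa using hg), zero_mul]
  rw [← key]
  refine L.sum_mem fun p _ => L.mul_mem p.1.2 ?_
  obtain ⟨t, ht⟩ := Algebra.IsInvariant.isInvariant (A := T) (G := G) _
    (groupTrace T S G ((p.2 : S) * (c * s))).2
  rw [coe_groupTrace] at ht
  rw [← ht]
  exact L.algebraMap_mem t

/-- The Galois correspondence between subgroups and separable subalgebras. -/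
noncomputable def galoisCorrespondence [Finite G] [Algebra.IsInvariant T S G] [Nontrivial S]
    (hS : ∀ s : S, s * s = s → s = 0 ∨ s = 1) (hB : IsGaloisCoordinates G B) :
    Subgroup G ≃o (SepSubalgebra T S)ᵒᵈ where
  toFun H := OrderDual.toDual
    ⟨FixedPoints.subalgebra T S H, hB.isSeparableAlgebra_fixedPoints H⟩
  invFun L := fixingSubgroup G ((OrderDual.ofDual L).1 : Set S)
  left_inv H := hB.fixingSubgroup_fixedPoints H
  right_inv L := by
    refine congrArg OrderDual.toDual (Subtype.ext ?_)
    exact hB.fixedPoints_fixingSubgroup hS (OrderDual.ofDual L).2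
  map_rel_iff' {H K} := by
    refine ⟨fun h => ?_, fun h s hs k => hs ⟨k, h k.2⟩⟩
    rw [← hB.fixingSubgroup_fixedPoints (T := T) H, ← hB.fixingSubgroup_fixedPoints (T := T) K]
    exact fixingSubgroup_antitone G S h

end IsGaloisCoordinates

end GaloisCorrespondence

/-! ### The determinant `Δ` -/

section Delta

theorem cyc_apply_of_lt {n : ℕ} {k j : Fin n} (h : j < k) : cyc k j = j :=
  Fin.cycleIcc_of_lt h

theorem cyc_pow_apply_of_lt {n : ℕ} {k j : Fin n} (h : j < k) (i : ℕ) : (cyc k ^ i) j = j := by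
  induction i with
  | zero => rfl
  | succ i ih => rw [pow_succ, Equiv.Perm.mul_apply, cyc_apply_of_lt h, ih]

/-- The bound `i < n - k` is what keeps the cycle from wrapping around. -/
theorem val_cyc_pow_apply_self {n : ℕ} (k : Fin n) (i : ℕ) (hi : i < n - k) :
    ((cyc k ^ i) k : ℕ) = k + i := by
  have : NeZero n := ⟨by have := k.2; omega⟩
  induction i with
  | zero => simp
  | succ i ih =>
    have ih := ih (by omega)
    rw [pow_succ', Equiv.Perm.mul_apply, cyc, Fin.cycleIcc_of_ge_of_lt]
    · change ((((cyc k ^ i) k) + 1 : Fin n) : ℕ) = _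
      rw [Fin.val_add_one_of_lt', ih]
      · ring
      · omega
    · change k ≤ (cyc k ^ i) k
      rw [Fin.le_def, ih]
      omega
    · change (cyc k ^ i) k < _
      rw [Fin.lt_def, ih]
      change _ < n - 1
      omega

/-- Greedy factorisation: the exponents are chosen one at a time so that the first `m` factors
already agree with π on the indices below `m`. -/
theorem exists_prod_ofFn_cyc_apply {n : ℕ} (π : Equiv.Perm (Fin n)) (m : ℕ) (hm : m ≤ n) :
    ∃ I : MultiIndex n, ∀ j : Fin n, (j : ℕ) < m →
      ((List.ofFn fun k : Fin m =>
        cyc (Fin.castLE hm k) ^ (I (Fin.castLE hm k) : ℕ)).prod)⁻¹ (π j) = j := by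
  induction m with
  | zero => exact ⟨fun k => ⟨0, by have := k.2; omega⟩, fun j hj => by simp at hj⟩
  | succ m ih =>
    obtain ⟨I, hI⟩ := ih (by omega)
    let P := (List.ofFn fun k : Fin m =>
        cyc (Fin.castLE (by omega : m ≤ n) k) ^ (I (Fin.castLE (by omega) k) : ℕ)).prod
    let k : Fin n := ⟨m, hm⟩
    let l : Fin n := P⁻¹ (π k)
    have hl : m ≤ (l : ℕ) := by
      by_contra hlt
      have h1 : P⁻¹ (π l) = l := hI l (by omega)
      have h2 : π l = π k := P⁻¹.injective h1
      have h3 : (l : ℕ) = m := congrArg Fin.val (π.injective h2)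
      omega
    -- The product `P` agrees with π below `m`, so `l = P⁻¹ (π m)` is at least `m`; the power `l -
    -- m` of the next cycle sends `m` to `l` and leaves the smaller indices alone.
    let I' : MultiIndex n := Function.update I k ⟨l - m, by have := l.2; change _ < n - m; omega⟩
    have hP : (List.ofFn fun k : Fin (m + 1) =>
        cyc (Fin.castLE hm k) ^ (I' (Fin.castLE hm k) : ℕ)).prod =
        P * cyc k ^ ((l : ℕ) - m) := by
      rw [List.ofFn_succ_last, List.prod_append, List.prod_singleton]
      congr 1
      · congr 2
        funext i
        have hne : Fin.castLE hm i.castSucc ≠ k := by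
          intro h
          have : (i : ℕ) = m := congrArg Fin.val h
          omega
        simp only [I', Function.update_of_ne hne]
        rfl
      · have hk : Fin.castLE hm (Fin.last m) = k := rfl
        rw [hk]
        simp [I']
    refine ⟨I', fun j hj => ?_⟩
    rw [hP, mul_inv_rev, Equiv.Perm.mul_apply, Equiv.Perm.inv_eq_iff_eq]
    by_cases hjm : (j : ℕ) < m
    · rw [cyc_pow_apply_of_lt (by exact hjm)]
      exact hI j hjm
    · have hjk : j = k := Fin.ext (by change (j : ℕ) = m; omega)
      rw [hjk]
      refine Fin.ext ?_
      rw [val_cyc_pow_apply_self]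
      · change (l : ℕ) = m + _
        omega
      · have := l.2
        change _ < n - m
        omega

theorem sigmaPow_surjective {n : ℕ} : Function.Surjective (sigmaPow (n := n)) := by
  intro π
  obtain ⟨I, hI⟩ := exists_prod_ofFn_cyc_apply π n le_rfl
  refine ⟨I, Equiv.ext fun j => ?_⟩
  exact (Equiv.Perm.inv_eq_iff_eq.1 (hI j j.2)).symm

theorem map_Delta {A A' : Type*} [CommRing A] [CommRing A'] (φ : A →+* A') {n : ℕ}
    (α : Fin n → A) : φ (Delta α) = Delta (φ ∘ α) := by
  rw [Delta, RingHom.map_det]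
  congr 1
  ext I J
  simp [vMatrix]

/-- The rows indexed by the identity and by the transposition of `i` and `j` coincide. -/
theorem Delta_eq_zero_of_eq {A : Type*} [CommRing A] {n : ℕ} (α : Fin n → A) {i j : Fin n}
    (hij : i ≠ j) (h : α i = α j) : Delta α = 0 := by
  obtain ⟨I, hI⟩ := sigmaPow_surjective (1 : Equiv.Perm (Fin n))
  obtain ⟨I', hI'⟩ := sigmaPow_surjective (Equiv.swap i j)
  refine Matrix.det_zero_of_row_eq (i := I) (j := I') ?_ ?_
  · rintro rfl
    rw [hI] at hI'
    have := congrArg (fun σ : Equiv.Perm (Fin n) => σ i) hI'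
    simp only [Equiv.Perm.one_apply, Equiv.swap_apply_left] at this
    exact hij this
  · funext J
    simp only [vMatrix, Matrix.of_apply, hI, hI', Equiv.Perm.one_apply]
    refine Finset.prod_congr rfl fun k _ => ?_
    congr 1
    rw [Equiv.swap_apply_def]
    split_ifs with h1 h2
    · rw [h1, h]
    · rw [h2, h]
    · rfl

/-- Modulo a maximal ideal containing `α i - α j` two roots collide, so Δ would lie in that ideal.
No closed formula for Δ is needed. -/
theorem isUnit_sub_of_isUnit_Delta {A : Type*} [CommRing A] {n : ℕ} {α : Fin n → A}
    (h : IsUnit (Delta α)) {i j : Fin n} (hij : i ≠ j) : IsUnit (α i - α j) := by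
  by_contra hu
  obtain ⟨m, hm, hmem⟩ := exists_max_ideal_of_mem_nonunits hu
  have h0 : Ideal.Quotient.mk m (Delta α) = 0 := by
    rw [map_Delta]
    exact Delta_eq_zero_of_eq _ hij (Ideal.Quotient.eq.2 hmem)
  exact hm.ne_top (Ideal.eq_top_of_isUnit_mem _ (Ideal.Quotient.eq_zero_iff_mem.1 h0) h)

end Delta

/-! ### Ring homomorphisms that agree on the invariants -/

/-- Packing the `s i` into one polynomial `p` produces a single `g` for all `i`. The product of `Y -
g p` over `g` has invariant coefficients, so its images under `a` and `b` agree. Thus `b(p)` is a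
root of the product of the `Y - a(g p)`, and `K[z]` is a domain. -/
theorem exists_forall_eq_of_eq_on_invariants {S K D : Type*} [CommRing S] [CommRing K] [IsDomain K]
    [Group D] [Finite D] [MulSemiringAction D S] {a b : S →+* K}
    (h : ∀ s : S, (∀ g : D, g • s = s) → a s = b s) {n : ℕ} (s : Fin n → S) :
    ∃ g : D, ∀ i, b (s i) = a (g • s i) := by
  have := Fintype.ofFinite D
  let p : S[X] := ∑ i : Fin n, monomial (i : ℕ) (s i)
  have hcoeff (i : Fin n) : p.coeff i = s i := by
    simp [p, coeff_monomial, Fin.val_inj]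
  have h1 : (MulSemiringAction.charpoly D p).map (mapRingHom a) =
      (MulSemiringAction.charpoly D p).map (mapRingHom b) := by
    ext k m
    simp only [coeff_map, coe_mapRingHom]
    refine h _ fun g => ?_
    rw [← coeff_smul, MulSemiringAction.smul_coeff_charpoly]
  have h2 : ((MulSemiringAction.charpoly D p).map (mapRingHom b)).eval (mapRingHom b p) = 0 := by
    rw [eval_map, eval₂_hom, MulSemiringAction.eval_charpoly, map_zero]
  rw [← h1, MulSemiringAction.charpoly_eq, Polynomial.map_prod, eval_prod,
    Finset.prod_eq_zero_iff] at h2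
  obtain ⟨g, -, hg⟩ := h2
  refine ⟨g, fun i => ?_⟩
  have h3 : p.map b = (g • p).map a := by
    simpa [sub_eq_zero] using hg
  have h4 := congrArg (fun r : K[X] => r.coeff i) h3
  simpa [coeff_map, hcoeff] using h4

/-! ### Coverings with finite fibres -/

section Coverings

variable {X Y Z : Type*} [TopologicalSpace X] [TopologicalSpace Y] [TopologicalSpace Z]

theorem IsCoveringMap.t2Space [T2Space X] {f : Y → X} (hf : IsCoveringMap f) : T2Space Y := by
  refine ⟨fun a b hab => ?_⟩
  by_cases h : f a = f b
  · exact hf.isSeparatedMap a b h hab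
  · obtain ⟨u, v, hu, hv, hau, hbv, huv⟩ := t2_separation h
    exact ⟨f ⁻¹' u, f ⁻¹' v, hu.preimage hf.continuous, hv.preimage hf.continuous, hau, hbv,
      huv.preimage f⟩

/-- Closedness is local on the base, and over an evenly covered open set the map is a projection
with finite, hence compact, fibre. -/
theorem IsCoveringMap.isProperMap {f : Y → X} (hf : IsCoveringMap f)
    (hfin : ∀ x, (f ⁻¹' {x}).Finite) : IsProperMap f := by
  refine isProperMap_iff_isClosedMap_and_compact_fibers.2
    ⟨hf.continuous, ?_, fun {x} => (hfin x).isCompact⟩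
  choose _ U hxU hU _ H hH using hf
  let V (x : X) : TopologicalSpace.Opens X := ⟨U x, hU x⟩
  have hV : TopologicalSpace.IsOpenCover V :=
    TopologicalSpace.IsOpenCover.mk (top_unique fun x _ => by
      simpa [V] using ⟨x, hxU x⟩)
  rw [hV.isClosedMap_iff_restrictPreimage]
  intro x
  have : Finite (f ⁻¹' {x}) := hfin x
  have h1 : (V x).1.restrictPreimage f = Prod.fst ∘ H x :=
    funext fun y => Subtype.ext (hH x y).symm
  rw [h1]
  exact isClosedMap_fst_of_compactSpace.comp (H x).isClosedMap

theorem IsLocalHomeomorph.finite_fiber {f : Y → X} (hf : IsLocalHomeomorph f)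
    (hp : IsProperMap f) (x : X) : (f ⁻¹' {x}).Finite := by
  refine (isProperMap_iff_isClosedMap_and_compact_fibers.1 hp).2.2 x |>.finite
    (IsDiscrete.of_openPartialHomeomorph f subset_rfl fun e _ => ?_)
  obtain ⟨φ, hφ, h⟩ := hf e
  exact ⟨φ, hφ, h.symm⟩

theorem IsLocalHomeomorph.isCoveringMap_of_isProperMap [T2Space Y] {f : Y → X}
    (hf : IsLocalHomeomorph f) (hp : IsProperMap f) : IsCoveringMap f := by
  rw [isCoveringMap_iff_isCoveringMapOn_univ]
  exact hp.isClosedMap.isCoveringMapOn_of_isLocalHomeomorphOn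
    (fun x _ => hf.finite_fiber hp x) hf.isLocalHomeomorphOn

/-- Properness and being a local homeomorphism both cancel from `r ∘ s`, and a proper local
homeomorphism from a Hausdorff space is a covering. -/
theorem IsCoveringMap.of_comp_of_finite [T2Space X] {r : Z → X} {s : Y → Z}
    (hr : IsCoveringMap r) (hs : Continuous s) (hrs : IsCoveringMap (r ∘ s))
    (hfin : ∀ x, ((r ∘ s) ⁻¹' {x}).Finite) : IsCoveringMap s ∧ IsProperMap s := by
  have := hr.t2Space
  have := hrs.t2Space
  have hp : IsProperMap s := isProperMap_of_comp_of_t2 hs hr.continuous (hrs.isProperMap hfin)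
  exact ⟨(hrs.isLocalHomeomorph.of_comp hr.isLocalHomeomorph hs).isCoveringMap_of_isProperMap hp,
    hp⟩

theorem IsCoveringMap.surjective [PathConnectedSpace X] [Nonempty Y] {f : Y → X}
    (hf : IsCoveringMap f) : Function.Surjective f := by
  intro x
  obtain ⟨y⟩ := ‹Nonempty Y›
  let γ := PathConnectedSpace.somePath (f y) x
  refine ⟨hf.liftPath γ y γ.source 1, ?_⟩
  have := congrFun (hf.liftPath_lifts γ y γ.source) 1
  simpa using this

theorem IsLocalHomeomorph.locallyPathConnectedSpace [LocallyPathConnectedSpace X] {f : Y → X}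
    (hf : IsLocalHomeomorph f) : LocallyPathConnectedSpace Y := by
  refine ⟨fun y => Filter.hasBasis_self.2 fun t ht => ?_⟩
  obtain ⟨φ, hφ, rfl⟩ := hf y
  have h1 : φ.target ∩ φ.symm ⁻¹' t ∈ 𝓝 (φ y) :=
    Filter.inter_mem (φ.open_target.mem_nhds (φ.map_source hφ))
      ((φ.tendsto_symm hφ) ht)
  obtain ⟨s, ⟨hs, hsc⟩, hst⟩ := (path_connected_basis (φ y)).mem_iff.1 h1
  change s ⊆ _ at hst
  refine ⟨φ.symm '' s, ?_, ?_, ?_⟩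
  · rw [φ.symm.image_eq_target_inter_inv_preimage fun z hz => (hst hz).1]
    simpa using ⟨φ.open_source.mem_nhds hφ, φ.continuousAt hφ hs⟩
  · exact hsc.image' (φ.continuousOn_symm.mono fun z hz => (hst hz).1)
  · rintro _ ⟨z, hz, rfl⟩
    exact (hst hz).2

theorem IsCoveringMap.comp_subtypeVal_of_isClopen [T2Space X] {f : Y → X} (hf : IsCoveringMap f)
    (hfin : ∀ x, (f ⁻¹' {x}).Finite) {C : Set Y} (hC : IsClopen C) :
    IsCoveringMap (fun y : C => f y) := by
  have := hf.t2Space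
  exact (hf.isLocalHomeomorph.comp
    hC.isOpen.isOpenEmbedding_subtypeVal.isLocalHomeomorph).isCoveringMap_of_isProperMap
    ((hf.isProperMap hfin).comp hC.isClosed.isClosedEmbedding_subtypeVal.isProperMap)

end Coverings

/-! ### Root functions of Weierstrass polynomials -/

section Roots

variable {X Y : Type*} [TopologicalSpace X] [TopologicalSpace Y]

theorem fiberPoly_eval_apply (f : C(X, ℂ)[X]) (β : C(X, ℂ)) (x : X) :
    (fiberPoly f x).eval (β x) = (f.eval β) x := by
  have := eval₂_hom (ContinuousMap.evalAlgHom ℂ ℂ x : C(X, ℂ) →ₐ[ℂ] ℂ).toRingHom β (p := f)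
  rw [fiberPoly, eval_map]
  exact this

theorem isFunRoot_iff {f : C(X, ℂ)[X]} {β : C(X, ℂ)} : IsFunRoot f β ↔ f.eval β = 0 := by
  simp_rw [IsFunRoot, fiberPoly_eval_apply, ContinuousMap.ext_iff, ContinuousMap.zero_apply]

@[simp]
theorem fiberPoly_map_pullback (q : C(Y, X)) (f : C(X, ℂ)[X]) (y : Y) :
    fiberPoly (f.map (pullback q)) y = fiberPoly f (q y) := by
  rw [fiberPoly, fiberPoly, Polynomial.map_map]
  rfl

theorem fiberPoly_derivative (f : C(X, ℂ)[X]) (x : X) :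
    fiberPoly (derivative f) x = derivative (fiberPoly f x) :=
  (derivative_map f _).symm

theorem isFunRoot_map_iff {q : C(Y, X)} {f : C(X, ℂ)[X]} {β : C(Y, ℂ)} :
    IsFunRoot (f.map (pullback q)) β ↔ ∀ y, (fiberPoly f (q y)).eval (β y) = 0 := by
  simp [IsFunRoot]

namespace SemiTopGalois.IsWeierstrass

variable {f : C(X, ℂ)[X]} {n : ℕ}

theorem finite_roots (hf : IsWeierstrass f n) (x : X) :
    {z : ℂ | (fiberPoly f x).eval z = 0}.Finite := by
  have h0 : fiberPoly f x ≠ 0 := (hf.monic.map _).ne_zero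
  refine (fiberPoly f x).roots.toFinset.finite_toSet.subset fun z hz => ?_
  simpa [h0] using hz

/-- A polynomial of degree `n` with `n` distinct roots has only simple roots. -/
theorem derivative_eval_ne_zero (hf : IsWeierstrass f n) {x : X} {z : ℂ}
    (hz : (fiberPoly f x).eval z = 0) : (fiberPoly (derivative f) x).eval z ≠ 0 := by
  have hm : (fiberPoly f x).Monic := hf.monic.map _
  have h0 : fiberPoly f x ≠ 0 := hm.ne_zero
  have hset : {z : ℂ | (fiberPoly f x).eval z = 0} = ((fiberPoly f x).roots.toFinset : Set ℂ) := by
    ext z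
    simp [h0]
  have hcard := hf.ncard_roots x
  rw [hset, Set.ncard_coe_finset] at hcard
  have hdeg : (fiberPoly f x).natDegree = n := by
    rw [fiberPoly, hf.monic.natDegree_map, hf.natDegree_eq]
  have hnodup : (fiberPoly f x).roots.Nodup := by
    rw [← Multiset.toFinset_card_eq_card_iff_nodup]
    exact le_antisymm (Multiset.toFinset_card_le _)
      (hcard ▸ hdeg ▸ card_roots' _)
  have hmult : (fiberPoly f x).rootMultiplicity z ≤ 1 := by
    rw [← count_roots]
    exact Multiset.nodup_iff_count_le_one.1 hnodup z
  intro hd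
  rw [fiberPoly_derivative] at hd
  exact absurd ((one_lt_rootMultiplicity_iff_isRoot h0).2 ⟨hz, hd⟩) (by omega)

/-- Two root functions on a connected space that agree at one point are equal. -/
theorem eq_of_apply_eq [PreconnectedSpace Y] (hf : IsWeierstrass f n) {q : C(Y, X)}
    {β γ : C(Y, ℂ)} (hβ : IsFunRoot (f.map (pullback q)) β)
    (hγ : IsFunRoot (f.map (pullback q)) γ) {y : Y} (hy : β y = γ y) : β = γ := by
  set F := f.map (pullback q) with hF
  -- Taylor expansion at β gives `(F'(β) + k (γ - β)) (γ - β) = 0`. Where β and γ agree the first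
  -- factor is `F'(β) ≠ 0`; it stays nonzero nearby, so the agreement set is open.
  obtain ⟨k, hk⟩ := F.binomExpansion β (γ - β)
  rw [add_sub_cancel, isFunRoot_iff.1 hγ, isFunRoot_iff.1 hβ] at hk
  let h : C(Y, ℂ) := F.derivative.eval β + k * (γ - β)
  have hprod (y : Y) : h y * (γ y - β y) = 0 := by
    have := congrArg (fun g : C(Y, ℂ) => g y) hk
    simp only [ContinuousMap.zero_apply, ContinuousMap.add_apply, ContinuousMap.mul_apply,
      ContinuousMap.sub_apply, ContinuousMap.pow_apply, zero_add] at this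
    simp only [h, ContinuousMap.add_apply, ContinuousMap.mul_apply, ContinuousMap.sub_apply]
    linear_combination -this
  have hclosed : IsClosed {y | β y = γ y} := isClosed_eq β.continuous γ.continuous
  have hopen : IsOpen {y | β y = γ y} := by
    rw [isOpen_iff_mem_nhds]
    intro y (hy : β y = γ y)
    have hne : h y ≠ 0 := by
      have h1 : h y = (F.derivative.eval β) y := by simp [h, hy]
      rw [h1, ← fiberPoly_eval_apply, hF, derivative_map, fiberPoly_map_pullback]
      exact hf.derivative_eval_ne_zero (isFunRoot_map_iff.1 hβ y)
    filter_upwards [h.continuous.continuousAt.eventually_ne hne] with y' hy'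
    exact (sub_eq_zero.1 ((mul_eq_zero.1 (hprod y')).resolve_left hy')).symm
  have huniv := IsClopen.eq_univ ⟨hclosed, hopen⟩ ⟨y, hy⟩
  exact ContinuousMap.ext fun y => huniv.ge (Set.mem_univ y)

end SemiTopGalois.IsWeierstrass

namespace SemiTopGalois.IsRootList

variable {f : C(X, ℂ)[X]} {n : ℕ} {q : C(Y, X)} {α : Fin n → C(Y, ℂ)}

theorem eval_eq_zero (hα : IsRootList q f α) (i : Fin n) (y : Y) :
    (fiberPoly f (q y)).eval (α i y) = 0 :=
  isFunRoot_map_iff.1 (hα.isFunRoot i) y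

variable [PreconnectedSpace Y]

theorem injective_apply (hf : IsWeierstrass f n) (hα : IsRootList q f α) (y : Y) :
    Function.Injective fun i => α i y := fun i j hij =>
  hα.injective (hf.eq_of_apply_eq (hα.isFunRoot i) (hα.isFunRoot j) hij)

theorem exists_apply_eq (hf : IsWeierstrass f n) (hα : IsRootList q f α) {y : Y} {z : ℂ}
    (hz : (fiberPoly f (q y)).eval z = 0) : ∃ i, α i y = z := by
  have hsub : Set.range (fun i => α i y) ⊆ {z : ℂ | (fiberPoly f (q y)).eval z = 0} := by
    rintro _ ⟨i, rfl⟩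
    exact hα.eval_eq_zero i y
  have hcard : (Set.range fun i => α i y).ncard = n := by
    rw [← Set.image_univ, Set.ncard_image_of_injective _ (hα.injective_apply hf y),
      Set.ncard_univ, Nat.card_eq_fintype_card, Fintype.card_fin]
  have heq := Set.eq_of_subset_of_ncard_le hsub (by rw [hf.ncard_roots, hcard])
    (hf.finite_roots (q y))
  exact heq.ge hz

theorem exists_eq (hf : IsWeierstrass f n) (hα : IsRootList q f α) [Nonempty Y] {β : C(Y, ℂ)}
    (hβ : IsFunRoot (f.map (pullback q)) β) : ∃ i, α i = β := by
  obtain ⟨y⟩ := ‹Nonempty Y›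
  obtain ⟨i, hi⟩ := hα.exists_apply_eq hf (isFunRoot_map_iff.1 hβ y)
  exact ⟨i, hf.eq_of_apply_eq (hα.isFunRoot i) hβ hi⟩

theorem exists_perm (hf : IsWeierstrass f n) (hα : IsRootList q f α) {y : Y} {z : Fin n → ℂ}
    (hz : Function.Injective z) (hz' : ∀ i, (fiberPoly f (q y)).eval (z i) = 0) :
    ∃ σ : Equiv.Perm (Fin n), ∀ i, α (σ i) y = z i := by
  choose σ hσ using fun i => hα.exists_apply_eq hf (hz' i)
  have hinj : Function.Injective σ := fun i j hij => hz (by rw [← hσ, ← hσ, hij])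
  exact ⟨Equiv.ofBijective σ (Finite.injective_iff_bijective.1 hinj), hσ⟩

end SemiTopGalois.IsRootList

end Roots

/-! ### The covering of orderings of the roots -/

section RootOrderings

variable {X E : Type*} [TopologicalSpace X] [TopologicalSpace E]

/-- Pairs of a point `x` and an ordering of the roots of `f_x`. -/
noncomputable def RootOrderings (f : C(X, ℂ)[X]) (n : ℕ) : Type _ :=
  {p : X × (Fin n → ℂ) // Function.Injective p.2 ∧ ∀ i, (fiberPoly f p.1).eval (p.2 i) = 0}

namespace RootOrderings

variable {f : C(X, ℂ)[X]} {n : ℕ} {q : C(E, X)} {α : Fin n → C(E, ℂ)}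

noncomputable instance : TopologicalSpace (RootOrderings f n) := instTopologicalSpaceSubtype

/-- The projection to the base. -/
noncomputable def proj (f : C(X, ℂ)[X]) (n : ℕ) : C(RootOrderings f n, X) :=
  ⟨fun p => p.1.1, continuous_fst.comp continuous_subtype_val⟩

/-- The `i`-th root, as a function on the space of orderings. -/
noncomputable def root (f : C(X, ℂ)[X]) (n : ℕ) (i : Fin n) : C(RootOrderings f n, ℂ) :=
  ⟨fun p => p.1.2 i, (continuous_apply i).comp (continuous_snd.comp continuous_subtype_val)⟩

theorem ext {p p' : RootOrderings f n} (h : proj f n p = proj f n p')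
    (h' : ∀ i, root f n i p = root f n i p') : p = p' :=
  Subtype.ext (Prod.ext h (funext h'))

theorem root_injective (p : RootOrderings f n) : Function.Injective fun i => root f n i p := p.2.1

theorem eval_root (p : RootOrderings f n) (i : Fin n) :
    (fiberPoly f (proj f n p)).eval (root f n i p) = 0 := p.2.2 i

variable [PreconnectedSpace E]

/-- The map to the space of orderings given by a permuted list of roots. -/
noncomputable def ofRoots (hf : IsWeierstrass f n) (hα : IsRootList q f α) (σ : Equiv.Perm (Fin n)) :
    C(E, RootOrderings f n) :=
  ⟨fun y => ⟨(q y, fun i => α (σ i) y), (hα.injective_apply hf y).comp σ.injective,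
    fun i => hα.eval_eq_zero (σ i) y⟩,
    Continuous.subtype_mk (by fun_prop) _⟩

@[simp]
theorem proj_ofRoots (hf : IsWeierstrass f n) (hα : IsRootList q f α) (σ : Equiv.Perm (Fin n))
    (y : E) : proj f n (ofRoots hf hα σ y) = q y := rfl

omit [PreconnectedSpace E] in
theorem finite_fiber (hf : IsWeierstrass f n) (x : X) : (proj f n ⁻¹' {x}).Finite := by
  have hfin : (Set.univ.pi fun _ : Fin n => {z : ℂ | (fiberPoly f x).eval z = 0}).Finite :=
    Set.Finite.pi fun _ => hf.finite_roots x
  refine Set.Finite.of_finite_image (f := fun p i => root f n i p) (hfin.subset ?_) ?_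
  · rintro _ ⟨p, rfl, rfl⟩ i -
    exact eval_root p i
  · intro p hp p' hp' h
    exact ext (hp.trans hp'.symm) fun i => congrFun h i

/-- A local section `s` of `q` makes `α ∘ s` a continuous ordering of the roots over `U`. Every
other ordering is a unique permutation of it, which trivialises the projection as `U × S_n`. -/
theorem isCoveringMap_proj (hf : IsWeierstrass f n) (hα : IsRootList q f α)
    (hq : IsCoveringMap q) (hsurj : Function.Surjective q) : IsCoveringMap (proj f n) := by
  intro x
  obtain ⟨e, rfl⟩ := hsurj x
  obtain ⟨_, U, hxU, hU, hU', H, hH⟩ := hq (q e)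
  let s (u : U) : E := (H.symm (u, (H ⟨e, hxU⟩).2)).1
  have hs (u : U) : q (s u) = u := by
    rw [← hH, H.apply_symm_apply]
  have hscont : Continuous s := by fun_prop
  let : TopologicalSpace (Equiv.Perm (Fin n)) := ⊥
  have : DiscreteTopology (Equiv.Perm (Fin n)) := ⟨rfl⟩
  let V := proj f n ⁻¹' U
  have hV : IsOpen V := hU.preimage (proj f n).continuous
  let b (p : V) : U := ⟨proj f n p.1, p.2⟩
  have hb : Continuous b := by fun_prop
  have hperm (p : V) : ∃ σ : Equiv.Perm (Fin n), ∀ i, α (σ i) (s (b p)) = root f n i p.1 :=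
    hα.exists_perm hf (root_injective p.1) fun i => by rw [hs]; exact eval_root p.1 i
  choose σ hσ using hperm
  have huniq (p : V) (τ : Equiv.Perm (Fin n)) (h : ∀ i, α (τ i) (s (b p)) = root f n i p.1) :
      σ p = τ := by
    refine Equiv.ext fun i => hα.injective_apply hf (s (b p)) ?_
    exact (hσ p i).trans (h i).symm
  -- Each level set of σ is cut out by equations between continuous functions, hence closed, and
  -- there are only finitely many of them.
  have hσcont : Continuous σ := by
    have hclosed (τ : Equiv.Perm (Fin n)) : IsClosed (σ ⁻¹' {τ}) := by
      have : σ ⁻¹' {τ} = {p | ∀ i, α (τ i) (s (b p)) = root f n i p.1} := by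
        ext p
        refine ⟨?_, huniq p τ⟩
        rintro rfl
        exact hσ p
      rw [this]
      simp only [Set.ofPred_forall]
      exact isClosed_iInter fun i => isClosed_eq (by fun_prop) (by fun_prop)
    refine continuous_iff_isClosed.2 fun A _ => ?_
    rw [← Set.biUnion_of_singleton A, Set.preimage_iUnion₂]
    exact A.toFinite.isClosed_biUnion fun τ _ => hclosed τ
  let K : V ≃ₜ U × Equiv.Perm (Fin n) :=
    { toFun := fun p => (b p, σ p)
      invFun := fun r => ⟨ofRoots hf hα r.2 (s r.1), by
        change q (s r.1) ∈ U
        rw [hs]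
        exact r.1.2⟩
      left_inv := fun p => Subtype.ext (ext (hs (b p)) fun i => hσ p i)
      right_inv := fun r => by
        have hbr : b ⟨ofRoots hf hα r.2 (s r.1), by
            change q (s r.1) ∈ U
            rw [hs]
            exact r.1.2⟩ = r.1 := Subtype.ext (hs r.1)
        refine Prod.ext hbr (huniq _ _ fun i => ?_)
        rw [hbr]
        rfl
      continuous_toFun := hb.prodMk hσcont
      continuous_invFun := by
        refine Continuous.subtype_mk ?_ _
        rw [continuous_prod_of_discrete_right]
        exact fun τ => (ofRoots hf hα τ).continuous.comp hscont }
  exact IsEvenlyCovered.to_isEvenlyCovered_preimage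
    ⟨inferInstance, U, hxU, hU, hV, K, fun _ => rfl⟩

end RootOrderings

end RootOrderings

/-! ### The splitting covering is a finite regular covering -/

section Splitting

variable {X E : Type u} [TopologicalSpace X] [TopologicalSpace E] [T2Space X]
  [PathConnectedSpace X] [LocallyPathConnectedSpace X] {f : C(X, ℂ)[X]} {n : ℕ} {q : C(E, X)}
  {α : Fin n → C(E, ℂ)}

namespace SemiTopGalois.IsSplittingCovering

/-- The splitting covering is a component of the covering of orderings of the roots. -/
theorem finite_and_homeomorph (hf : IsWeierstrass f n) (hq : IsSplittingCovering q f n)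
    [PathConnectedSpace E] (hα : IsRootList q f α) (e₀ : E) :
    (∀ x, (q ⁻¹' {x}).Finite) ∧
      ∃ Ψ : E ≃ₜ connectedComponent (RootOrderings.ofRoots hf hα 1 e₀),
        ∀ e, (Ψ e : RootOrderings f n) = RootOrderings.ofRoots hf hα 1 e := by
  let c₀ := RootOrderings.ofRoots hf hα 1 e₀
  let C := connectedComponent c₀
  have hqs : Function.Surjective q := hq.isCoveringMap.surjective
  have hP := RootOrderings.isCoveringMap_proj hf hα hq.isCoveringMap hqs
  have hPfin := RootOrderings.finite_fiber (n := n) hf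
  have : LocallyPathConnectedSpace (RootOrderings f n) :=
    hP.isLocalHomeomorph.locallyPathConnectedSpace
  have hC : IsClopen C := isClopen_connectedComponent
  have : LocallyPathConnectedSpace C := hC.isOpen.locallyPathConnectedSpace
  have : ConnectedSpace C := isConnected_iff_connectedSpace.1 isConnected_connectedComponent
  have : PathConnectedSpace C := PathConnectedSpace.of_locallyPathConnectedSpace
  let p : C(C, X) := ⟨fun c => RootOrderings.proj f n c, by fun_prop⟩
  have hp : IsCoveringMap p := hP.comp_subtypeVal_of_isClopen hPfin hC
  have hpfin (x : X) : (p ⁻¹' {x}).Finite :=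
    Set.Finite.preimage (f := ((↑) : C → RootOrderings f n)) Subtype.val_injective.injOn (hPfin x)
  have hsplit : SplitsIn p f n := by
    refine ⟨fun i => ⟨fun c => RootOrderings.root f n i c, by fun_prop⟩, ?_, fun i => ?_⟩
    · intro i j hij
      exact RootOrderings.root_injective c₀
        (DFunLike.congr_fun hij (⟨c₀, mem_connectedComponent⟩ : C))
    · exact isFunRoot_map_iff.2 fun c => RootOrderings.eval_root _ i
  obtain ⟨π, hπ, hπq⟩ := hq.minimal C p hp hsplit
  have hqπ (c : C) : q (π c) = p c := DFunLike.congr_fun hπq c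
  have hπs : Function.Surjective π := hπ.surjective
  have hqfin (x : X) : (q ⁻¹' {x}).Finite := by
    refine ((hpfin x).image π).subset fun e he => ?_
    obtain ⟨c, rfl⟩ := hπs e
    exact ⟨c, (hqπ c).symm.trans he, rfl⟩
  let ρ : C(E, C) := ⟨fun e => ⟨RootOrderings.ofRoots hf hα 1 e,
    (isPreconnected_range (RootOrderings.ofRoots hf hα 1).continuous).subset_connectedComponent
      ⟨e₀, rfl⟩ ⟨e, rfl⟩⟩, by fun_prop⟩
  have hρ : IsCoveringMap ρ ∧ IsProperMap ρ :=
    hp.of_comp_of_finite ρ.continuous hq.isCoveringMap hqfin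
  have hρs : Function.Surjective ρ := hρ.1.surjective
  -- On a finite fibre of `q` the self-map `π ∘ ρ` is surjective, hence injective, and so is ρ.
  have hρi : Function.Injective ρ := by
    intro e e' h
    have hqe : q e' = q e := congrArg p h.symm
    have : Finite (q ⁻¹' {q e}) := hqfin (q e)
    let g (y : q ⁻¹' {q e}) : q ⁻¹' {q e} := ⟨π (ρ y), (hqπ (ρ y)).trans y.2⟩
    have hg : Function.Surjective g := by
      rintro ⟨y, hy⟩
      obtain ⟨c, rfl⟩ := hπs y
      obtain ⟨z, rfl⟩ := hρs c
      exact ⟨⟨z, (hqπ (ρ z)).symm.trans hy⟩, rfl⟩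
    have := Finite.injective_iff_surjective.2 hg (a₁ := ⟨e, rfl⟩) (a₂ := ⟨e', hqe⟩)
      (Subtype.ext (congrArg π h))
    exact congrArg Subtype.val this
  exact ⟨hqfin, (Equiv.ofBijective ρ ⟨hρi, hρs⟩).toHomeomorphOfContinuousOpen ρ.continuous
    hρ.1.isOpenMap, fun e => rfl⟩

theorem finite_fiber (hf : IsWeierstrass f n) (hq : IsSplittingCovering q f n) (x : X) :
    (q ⁻¹' {x}).Finite := by
  have := hq.pathConnected
  obtain ⟨α, hα⟩ := hq.splits
  obtain ⟨e₀⟩ := (inferInstance : Nonempty E)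
  exact (hq.finite_and_homeomorph hf hα e₀).1 x

/-- The points of a fibre are separated by the roots. -/
theorem eq_of_roots_eq (hf : IsWeierstrass f n) (hq : IsSplittingCovering q f n)
    (hα : IsRootList q f α) {e e' : E} (h : q e = q e') (h' : ∀ i, α i e = α i e') : e = e' := by
  have := hq.pathConnected
  obtain ⟨-, Ψ, hΨ⟩ := hq.finite_and_homeomorph hf hα e
  refine Ψ.injective (Subtype.ext ?_)
  rw [hΨ, hΨ]
  exact RootOrderings.ext h h'

/-- Permuting the roots by the σ that matches their values at `e` with those at `e'` gives another
map into the orderings. It meets the component of `e'`, hence stays in it, and `Ψ⁻¹` brings it back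
to `E`. -/
theorem exists_continuousMap (hf : IsWeierstrass f n) (hq : IsSplittingCovering q f n)
    {e e' : E} (h : q e = q e') : ∃ φ : C(E, E), (∀ y, q (φ y) = q y) ∧ φ e = e' := by
  have := hq.pathConnected
  obtain ⟨α, hα⟩ := hq.splits
  obtain ⟨-, Ψ, hΨ⟩ := hq.finite_and_homeomorph hf hα e'
  have hqΨ (c) : q (Ψ.symm c) = RootOrderings.proj f n c := by
    rw [← RootOrderings.proj_ofRoots hf hα 1, ← hΨ, Ψ.apply_symm_apply]
  obtain ⟨σ, hσ⟩ := hα.exists_perm hf (y := e) (hα.injective_apply hf e')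
    fun i => by rw [h]; exact hα.eval_eq_zero i e'
  have he : RootOrderings.ofRoots hf hα σ e = RootOrderings.ofRoots hf hα 1 e' :=
    RootOrderings.ext h hσ
  let ρ : C(E, connectedComponent (RootOrderings.ofRoots hf hα 1 e')) :=
    ⟨fun y => ⟨RootOrderings.ofRoots hf hα σ y,
      (isPreconnected_range (RootOrderings.ofRoots hf hα σ).continuous).subset_connectedComponent
        ⟨e, he⟩ ⟨y, rfl⟩⟩, by fun_prop⟩
  refine ⟨⟨fun y => Ψ.symm (ρ y), by fun_prop⟩, fun y => ?_, ?_⟩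
  · exact hqΨ (ρ y)
  · change Ψ.symm (ρ e) = e'
    rw [Homeomorph.symm_apply_eq]
    exact Subtype.ext (he.trans (hΨ e').symm)

/-- Covering transformations act transitively on the fibres. -/
theorem exists_deck (hf : IsWeierstrass f n) (hq : IsSplittingCovering q f n)
    {e e' : E} (h : q e = q e') : ∃ Φ : deck q, (Φ : E ≃ₜ E) e = e' := by
  have := hq.pathConnected
  obtain ⟨φ, hφ, hφe⟩ := hq.exists_continuousMap hf h
  obtain ⟨ψ, hψ, hψe⟩ := hq.exists_continuousMap hf h.symm
  -- Either composite lifts `q` and fixes a point, so it is the identity by uniqueness of lifts.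
  have hid (a b : C(E, E)) (ha : ∀ y, q (a y) = q y) (hb : ∀ y, q (b y) = q y) (y : E)
      (hy : b (a y) = y) (z : E) : b (a z) = z :=
    congrFun (hq.isCoveringMap.eq_of_comp_eq (g₁ := b ∘ a) (g₂ := id) (by fun_prop) continuous_id
      (funext fun z => by simp [ha, hb]) y hy) z
  exact ⟨⟨⟨⟨φ, ψ, hid φ ψ hφ hψ e (by rw [hφe, hψe]), hid ψ φ hψ hφ e' (by rw [hψe, hφe])⟩,
    φ.continuous, ψ.continuous⟩, hφ⟩, hφe⟩

end SemiTopGalois.IsSplittingCovering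

end Splitting

/-! ### Intermediate coverings of a finite regular covering -/

section Deck

variable {X E : Type u} [TopologicalSpace X] [TopologicalSpace E] {q : C(E, X)}

namespace SemiTopGalois

theorem apply_deck (Φ : deck q) (y : E) : q ((Φ : E ≃ₜ E) y) = q y := Φ.2 y

theorem deck_mul_apply (Φ Ψ : deck q) (y : E) :
    ((Φ * Ψ : deck q) : E ≃ₜ E) y = (Φ : E ≃ₜ E) ((Ψ : E ≃ₜ E) y) := rfl

theorem deck_ext [PreconnectedSpace E] (hq : IsCoveringMap q) {Φ Ψ : deck q} (e : E)
    (h : (Φ : E ≃ₜ E) e = (Ψ : E ≃ₜ E) e) : Φ = Ψ := by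
  refine Subtype.ext (Homeomorph.ext fun y => ?_)
  exact congrFun (hq.eq_of_comp_eq (Φ : E ≃ₜ E).continuous (Ψ : E ≃ₜ E).continuous
    (funext fun y => (apply_deck Φ y).trans (apply_deck Ψ y).symm) e h) y

theorem finite_deck [ConnectedSpace E] (hq : IsCoveringMap q) (hfin : ∀ x, (q ⁻¹' {x}).Finite) :
    Finite (deck q) := by
  obtain ⟨e⟩ := (inferInstance : Nonempty E)
  have : Finite (q ⁻¹' {q e}) := hfin (q e)
  exact Finite.of_injective (fun Φ : deck q => (⟨(Φ : E ≃ₜ E) e, apply_deck Φ e⟩ : q ⁻¹' {q e}))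
    fun Φ Ψ h => deck_ext hq e (congrArg Subtype.val h)

end SemiTopGalois

end Deck

namespace SemiTopGalois.IntermediateCovering

variable {X E : Type u} [TopologicalSpace X] [TopologicalSpace E] {q : C(E, X)} {e₀ : E}

theorem toBase_fromTop (L : IntermediateCovering q e₀) (e : E) :
    L.toBase (L.fromTop e) = q e :=
  DFunLike.congr_fun L.comp_eq e

theorem mem_deckOver {L : IntermediateCovering q e₀} {Φ : deck q} :
    Φ ∈ L.deckOver ↔ ∀ y, L.fromTop ((Φ : E ≃ₜ E) y) = L.fromTop y := Iff.rfl

theorem surjective_fromTop (L : IntermediateCovering q e₀) : Function.Surjective L.fromTop :=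
  have : Nonempty E := ⟨e₀⟩
  L.isCoveringMap_fromTop.surjective

theorem isQuotientMap_fromTop (L : IntermediateCovering q e₀) : IsQuotientMap L.fromTop :=
  L.isCoveringMap_fromTop.isQuotientMap L.surjective_fromTop

theorem finite_toBase_fiber (L : IntermediateCovering q e₀) (hfin : ∀ x, (q ⁻¹' {x}).Finite)
    (x : X) : (L.toBase ⁻¹' {x}).Finite := by
  refine ((hfin x).image L.fromTop).subset fun l hl => ?_
  obtain ⟨e, rfl⟩ := L.surjective_fromTop l
  exact ⟨e, (L.toBase_fromTop e).symm.trans hl, rfl⟩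

section Connected

variable [PathConnectedSpace E]

/-- Both `L.fromTop ∘ Φ` and `L.fromTop` lift `q` to `L`, so agreement at one point is enough. -/
theorem mem_deckOver_of_apply_eq (L : IntermediateCovering q e₀) {Φ : deck q} {e : E}
    (h : L.fromTop ((Φ : E ≃ₜ E) e) = L.fromTop e) : Φ ∈ L.deckOver := by
  refine mem_deckOver.2 fun y => congrFun (L.isCoveringMap_toBase.eq_of_comp_eq
    (g₁ := L.fromTop ∘ (Φ : E ≃ₜ E)) (g₂ := L.fromTop)
    (L.fromTop.continuous.comp (Φ : E ≃ₜ E).continuous) L.fromTop.continuous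
    (funext fun y => ?_) e h) y
  simp [toBase_fromTop, apply_deck]

theorem fromTop_eq_iff (L : IntermediateCovering q e₀)
    (htrans : ∀ e e', q e = q e' → ∃ Φ : deck q, (Φ : E ≃ₜ E) e = e') {e e' : E} :
    L.fromTop e = L.fromTop e' ↔ ∃ Φ ∈ L.deckOver, (Φ : E ≃ₜ E) e = e' := by
  constructor
  · intro h
    obtain ⟨Φ, hΦ⟩ := htrans e e' (by rw [← L.toBase_fromTop, h, L.toBase_fromTop])
    exact ⟨Φ, L.mem_deckOver_of_apply_eq (by rw [hΦ, h]), hΦ⟩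
  · rintro ⟨Φ, hΦ, rfl⟩
    exact (mem_deckOver.1 hΦ e).symm

theorem IsCoveringOver.apply_fromTop {L M : IntermediateCovering q e₀}
    {s : C(L.carrier, M.carrier)} (hs : L.IsCoveringOver M s) (e : E) :
    s (L.fromTop e) = M.fromTop e := by
  refine congrFun (M.isCoveringMap_toBase.eq_of_comp_eq (g₁ := s ∘ L.fromTop) (g₂ := M.fromTop)
    (s.continuous.comp L.fromTop.continuous) M.fromTop.continuous (funext fun y => ?_) e₀ ?_) e
  · have := DFunLike.congr_fun hs.comp_eq (L.fromTop y)
    simpa [toBase_fromTop] using this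
  · simp [L.map_point, M.map_point, hs.map_point]

theorem IsCoveringOver.deckOver_le {L M : IntermediateCovering q e₀}
    {s : C(L.carrier, M.carrier)} (hs : L.IsCoveringOver M s) : L.deckOver ≤ M.deckOver := by
  intro Φ hΦ
  refine mem_deckOver.2 fun y => ?_
  rw [← hs.apply_fromTop, ← hs.apply_fromTop, mem_deckOver.1 hΦ]

/-- The fibres of `E → L` are the orbits of `A(E/L)`. Inclusion of groups therefore lets `E → M`
descend along the quotient map `E → L`, and cancellation makes the descended map a covering. -/
theorem exists_isCoveringOver_iff [T2Space X] (hfin : ∀ x, (q ⁻¹' {x}).Finite)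
    (htrans : ∀ e e', q e = q e' → ∃ Φ : deck q, (Φ : E ≃ₜ E) e = e')
    (L M : IntermediateCovering q e₀) :
    (∃ s, L.IsCoveringOver M s) ↔ L.deckOver ≤ M.deckOver := by
  refine ⟨fun ⟨s, hs⟩ => hs.deckOver_le, fun h => ?_⟩
  have hcomp (e e' : E) (he : L.fromTop e = L.fromTop e') : M.fromTop e = M.fromTop e' := by
    obtain ⟨Φ, hΦ, rfl⟩ := (L.fromTop_eq_iff htrans).1 he
    exact (mem_deckOver.1 (h hΦ) e).symm
  let s : C(L.carrier, M.carrier) := L.isQuotientMap_fromTop.lift M.fromTop hcomp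
  have hs (e : E) : s (L.fromTop e) = M.fromTop e :=
    DFunLike.congr_fun (L.isQuotientMap_fromTop.lift_comp M.fromTop hcomp) e
  have hsq : M.toBase ∘ s = L.toBase := by
    funext l
    obtain ⟨e, rfl⟩ := L.surjective_fromTop l
    simp [hs, toBase_fromTop]
  refine ⟨s, ?_, DFunLike.coe_injective hsq, ?_⟩
  · refine (M.isCoveringMap_toBase.of_comp_of_finite s.continuous ?_ ?_).1 <;> rw [hsq]
    · exact L.isCoveringMap_toBase
    · exact L.finite_toBase_fiber hfin
  · rw [← L.map_point, hs, M.map_point]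

theorem Iso.deckOver_le {L M : IntermediateCovering q e₀} (h : Iso L M) :
    L.deckOver ≤ M.deckOver := by
  obtain ⟨h, h1, h2⟩ := h
  exact IsCoveringOver.deckOver_le (s := (h : C(L.carrier, M.carrier)))
    ⟨(isCoveringMap_id M.carrier).comp_homeomorph h, ContinuousMap.ext h1, h2⟩

theorem iso_iff [T2Space X] (hfin : ∀ x, (q ⁻¹' {x}).Finite)
    (htrans : ∀ e e', q e = q e' → ∃ Φ : deck q, (Φ : E ≃ₜ E) e = e')
    (L M : IntermediateCovering q e₀) : Iso L M ↔ L.deckOver = M.deckOver := by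
  constructor
  · exact fun h => le_antisymm h.deckOver_le (((isoSetoid q e₀).symm h : Iso M L).deckOver_le)
  · intro h
    obtain ⟨s, hs⟩ := (exists_isCoveringOver_iff hfin htrans L M).2 h.le
    obtain ⟨t, ht⟩ := (exists_isCoveringOver_iff hfin htrans M L).2 h.ge
    refine ⟨⟨⟨s, t, fun l => ?_, fun m => ?_⟩, s.continuous, t.continuous⟩,
      DFunLike.congr_fun hs.comp_eq, hs.map_point⟩
    · obtain ⟨e, rfl⟩ := L.surjective_fromTop l
      rw [hs.apply_fromTop, ht.apply_fromTop]
    · obtain ⟨e, rfl⟩ := M.surjective_fromTop m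
      rw [ht.apply_fromTop, hs.apply_fromTop]

/-- The fibres of `L → M` are in bijection with the cosets of `A(E/L)` in `A(E/M)`. -/
theorem IsCoveringOver.fiber (hq : IsCoveringMap q) (hfin : ∀ x, (q ⁻¹' {x}).Finite)
    (htrans : ∀ e e', q e = q e' → ∃ Φ : deck q, (Φ : E ≃ₜ E) e = e')
    {L M : IntermediateCovering q e₀} {s : C(L.carrier, M.carrier)} (hs : L.IsCoveringOver M s)
    (m : M.carrier) :
    (s ⁻¹' {m}).Finite ∧ (s ⁻¹' {m}).ncard = L.deckOver.relIndex M.deckOver := by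
  constructor
  · refine (L.finite_toBase_fiber hfin (M.toBase m)).subset ?_
    rintro l rfl
    exact (DFunLike.congr_fun hs.comp_eq l).symm
  obtain ⟨e, rfl⟩ := M.surjective_fromTop m
  -- The inverse fits left cosets: `Ψ⁻¹ e` is the image of `Φ⁻¹ e` under `(Φ⁻¹ Ψ)⁻¹`.
  let g (Φ : M.deckOver) : s ⁻¹' {M.fromTop e} :=
    ⟨L.fromTop ((((Φ : deck q)⁻¹ : deck q) : E ≃ₜ E) e), by
      rw [Set.mem_preimage, hs.apply_fromTop]
      exact mem_deckOver.1 (M.deckOver.inv_mem Φ.2) e⟩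
  have hg (Φ Ψ : M.deckOver) :
      QuotientGroup.leftRel (L.deckOver.subgroupOf M.deckOver) Φ Ψ ↔ g Φ = g Ψ := by
    rw [QuotientGroup.leftRel_apply, Subgroup.mem_subgroupOf, Subtype.ext_iff,
      L.fromTop_eq_iff htrans]
    constructor
    · intro h
      refine ⟨_, L.deckOver.inv_mem h, ?_⟩
      rw [← deck_mul_apply]
      simp
    · rintro ⟨Θ, hΘ, h⟩
      have h1 : Θ * (Φ : deck q)⁻¹ = (Ψ : deck q)⁻¹ := deck_ext hq e h
      have h2 : ((Φ⁻¹ * Ψ : M.deckOver) : deck q) = Θ⁻¹ := by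
        rw [mul_inv_eq_iff_eq_mul] at h1
        simp [h1]
      rw [h2]
      exact L.deckOver.inv_mem hΘ
  let k : M.deckOver ⧸ L.deckOver.subgroupOf M.deckOver → s ⁻¹' {M.fromTop e} :=
    Quotient.lift g fun Φ Ψ h => (hg Φ Ψ).1 h
  have hk : Function.Bijective k := by
    constructor
    · rintro ⟨Φ⟩ ⟨Ψ⟩ h
      exact Quotient.sound ((hg Φ Ψ).2 h)
    · rintro ⟨l, hl⟩
      obtain ⟨y, rfl⟩ := L.surjective_fromTop l
      rw [Set.mem_preimage, hs.apply_fromTop] at hl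
      obtain ⟨Φ, hΦ, rfl⟩ := (M.fromTop_eq_iff htrans).1 (Set.mem_singleton_iff.1 hl).symm
      refine ⟨QuotientGroup.mk ⟨Φ⁻¹, M.deckOver.inv_mem hΦ⟩, Subtype.ext ?_⟩
      change L.fromTop ((((Φ⁻¹)⁻¹ : deck q) : E ≃ₜ E) e) = _
      rw [inv_inv]
  exact (Nat.card_congr (Equiv.ofBijective k hk)).symm

/-! #### The quotient by a subgroup of the deck group -/

/-- The orbit relation of a subgroup of the deck group. -/
def orbitSetoid (H : Subgroup (deck q)) : Setoid E where
  r e e' := ∃ Φ ∈ H, (Φ : E ≃ₜ E) e = e'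
  iseqv :=
    { refl := fun e => ⟨1, H.one_mem, rfl⟩
      symm := by
        rintro e _ ⟨Φ, hΦ, rfl⟩
        exact ⟨Φ⁻¹, H.inv_mem hΦ, (Φ : E ≃ₜ E).symm_apply_apply e⟩
      trans := by
        rintro e _ _ ⟨Φ, hΦ, rfl⟩ ⟨Ψ, hΨ, rfl⟩
        exact ⟨Ψ * Φ, H.mul_mem hΨ hΦ, rfl⟩ }

/-- The covering is `E/H`. It is Hausdorff because the orbit relation is a finite union of closed
graphs. Its projection to `X` inherits properness and the local homeomorphism property from `q`. -/
theorem exists_deckOver_eq [T2Space X] (hq : IsCoveringMap q)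
    (hfin : ∀ x, (q ⁻¹' {x}).Finite) (e₀ : E) (H : Subgroup (deck q)) :
    ∃ L : IntermediateCovering q e₀, L.deckOver = H := by
  have := hq.t2Space
  have := finite_deck hq hfin
  let Q := Quotient (orbitSetoid H)
  let mk : E → Q := Quotient.mk (orbitSetoid H)
  have hmk {e e' : E} : mk e = mk e' ↔ ∃ Φ ∈ H, (Φ : E ≃ₜ E) e = e' := Quotient.eq
  have hmks : Function.Surjective mk := Quotient.mk_surjective
  have hmkc : Continuous mk := continuous_quotient_mk'
  have hmko : IsOpenMap mk := by
    intro U hU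
    change IsOpen (mk ⁻¹' (mk '' U))
    have : mk ⁻¹' (mk '' U) = ⋃ Φ ∈ H, (Φ : E ≃ₜ E) '' U := by
      ext e
      simp only [Set.mem_preimage, Set.mem_image, Set.mem_iUnion, exists_prop, hmk]
      constructor
      · rintro ⟨y, hy, Φ, hΦ, h⟩
        exact ⟨Φ, hΦ, y, hy, h⟩
      · rintro ⟨Φ, hΦ, y, hy, h⟩
        exact ⟨y, hy, Φ, hΦ, h⟩
    rw [this]
    exact isOpen_biUnion fun Φ _ => (Φ : E ≃ₜ E).isOpenMap U hU
  have hT2 : T2Space Q := by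
    rw [t2Space_iff_of_isOpenQuotientMap ⟨hmks, hmkc, hmko⟩]
    have : {p : E × E | mk p.1 = mk p.2} =
        ⋃ Φ ∈ (H : Set (deck q)), {p : E × E | (Φ : E ≃ₜ E) p.1 = p.2} := by
      ext p
      simp [hmk]
    rw [this]
    exact (Set.toFinite _).isClosed_biUnion fun Φ _ =>
      isClosed_eq ((Φ : E ≃ₜ E).continuous.comp continuous_fst) continuous_snd
  let r : Q → X := Quotient.lift q (by
    rintro e _ ⟨Φ, -, rfl⟩
    exact (apply_deck Φ e).symm)
  have hr : r ∘ mk = q := rfl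
  have hrc : Continuous r := continuous_quot_lift _ q.continuous
  have hmkl : IsLocalHomeomorph mk := by
    rw [isLocalHomeomorph_iff_isOpenEmbedding_restrict]
    intro e
    obtain ⟨U, hU, heU, hinj⟩ := hq.isLocalHomeomorph.isLocallyInjective e
    refine ⟨U, hU.mem_nhds heU, .of_continuous_injective_isOpenMap
      (hmkc.comp continuous_subtype_val) ?_ (hmko.comp hU.isOpenMap_subtype_val)⟩
    intro a b hab
    exact Subtype.ext (hinj a.2 b.2 (congrArg r hab))
  have hrl : IsLocalHomeomorph r := by
    rw [isLocalHomeomorph_iff_isLocalHomeomorphOn_univ, ← hmks.range_eq, ← Set.image_univ]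
    exact IsLocalHomeomorphOn.of_comp_right hq.isLocalHomeomorph.isLocalHomeomorphOn
      hmkl.isLocalHomeomorphOn
  have hrcov : IsCoveringMap r := hrl.isCoveringMap_of_isProperMap
    (isProperMap_of_comp_of_surj hmkc hrc (hq.isProperMap hfin) hmks)
  have : PathConnectedSpace Q := hmks.pathConnectedSpace hmkc
  let L : IntermediateCovering q e₀ :=
    { carrier := Q
      point := mk e₀
      fromTop := ⟨mk, hmkc⟩
      toBase := ⟨r, hrc⟩
      isCoveringMap_fromTop := (hrcov.of_comp_of_finite hmkc hq hfin).1
      isCoveringMap_toBase := hrcov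
      comp_eq := rfl
      map_point := rfl }
  refine ⟨L, le_antisymm (fun Φ hΦ => ?_) fun Φ hΦ => mem_deckOver.2 fun y =>
    (hmk.2 ⟨Φ, hΦ, rfl⟩).symm⟩
  -- Some `Ψ ∈ H` undoes Φ at `e₀`, hence everywhere, so Φ is its inverse.
  obtain ⟨Ψ, hΨ, h⟩ := hmk.1 (mem_deckOver.1 hΦ e₀)
  have : Ψ * Φ = 1 := deck_ext hq e₀ h
  rw [← inv_eq_of_mul_eq_one_right this]
  exact H.inv_mem hΨ

/-- Isomorphism classes of intermediate coverings correspond to subgroups of the deck group. -/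
noncomputable def isoClassEquiv [T2Space X] (hq : IsCoveringMap q)
    (hfin : ∀ x, (q ⁻¹' {x}).Finite)
    (htrans : ∀ e e', q e = q e' → ∃ Φ : deck q, (Φ : E ≃ₜ E) e = e') (e₀ : E) :
    Quotient (isoSetoid q e₀) ≃ Subgroup (deck q) :=
  Equiv.ofBijective
    (Quotient.lift deckOver fun L M h => (iso_iff hfin htrans L M).1 h) (by
      constructor
      · rintro ⟨L⟩ ⟨M⟩ h
        exact Quotient.sound ((iso_iff hfin htrans L M).2 h)
      · intro H
        obtain ⟨L, hL⟩ := exists_deckOver_eq hq hfin e₀ H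
        exact ⟨Quotient.mk _ L, hL⟩)

end Connected

end SemiTopGalois.IntermediateCovering

/-! ### The isomorphism between the deck group and the Galois group -/

section Omega

variable {X E : Type u} [TopologicalSpace X] [TopologicalSpace E] {f : C(X, ℂ)[X]} {n : ℕ}
  {q : C(E, X)} {α : Fin n → C(E, ℂ)} {T : Subring C(E, ℂ)}

/-- A covering transformation acts on `C(E)` by `β ↦ β ∘ Φ⁻¹`, and fixes `T ⊆ q* C(X)`. -/
noncomputable def deckAlgHom (hT : T ≤ (pullback q).range) (Φ : deck q) :
    C(E, ℂ) →ₐ[T] C(E, ℂ) :=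
  { (ContinuousMap.compRightAlgHom ℂ ℂ ((Φ : E ≃ₜ E).symm : C(E, E))).toRingHom with
    commutes' := fun t => by
      obtain ⟨γ, hγ⟩ := hT t.2
      ext y
      change (t : C(E, ℂ)) ((Φ : E ≃ₜ E).symm y) = (t : C(E, ℂ)) y
      rw [← hγ]
      exact congrArg γ (apply_deck Φ⁻¹ y) }

theorem deckAlgHom_apply (hT : T ≤ (pullback q).range) (Φ : deck q) (β : C(E, ℂ)) (y : E) :
    deckAlgHom hT Φ β y = β ((Φ : E ≃ₜ E).symm y) := rfl

theorem isFunRoot_deckAlgHom (hα : IsRootList q f α) (hT : T ≤ (pullback q).range) (Φ : deck q)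
    (i : Fin n) : IsFunRoot (f.map (pullback q)) (deckAlgHom hT Φ (α i)) := by
  refine isFunRoot_map_iff.2 fun y => ?_
  rw [deckAlgHom_apply, ← apply_deck Φ⁻¹ y]
  exact hα.eval_eq_zero i _

variable [PathConnectedSpace E]

theorem deckAlgHom_mem (hf : IsWeierstrass f n) (hα : IsRootList q f α)
    (hT : T ≤ (pullback q).range) (Φ : deck q) {β : C(E, ℂ)} (hβ : β ∈ adjoinRoots T α) :
    deckAlgHom hT Φ β ∈ adjoinRoots T α := by
  have h1 : (adjoinRoots T α).map (deckAlgHom hT Φ) ≤ adjoinRoots T α := by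
    rw [AlgHom.map_adjoin, Algebra.adjoin_le_iff]
    rintro _ ⟨_, ⟨i, rfl⟩, rfl⟩
    obtain ⟨j, hj⟩ := hα.exists_eq hf (isFunRoot_deckAlgHom hα hT Φ i)
    exact Algebra.subset_adjoin ⟨j, hj⟩
  exact h1 ⟨β, hβ, rfl⟩

/-- The action of a covering transformation on `T[α]`. -/
noncomputable def deckRestrict (hf : IsWeierstrass f n) (hα : IsRootList q f α)
    (hT : T ≤ (pullback q).range) (Φ : deck q) : adjoinRoots T α →ₐ[T] adjoinRoots T α :=
  ((deckAlgHom hT Φ).comp (adjoinRoots T α).val).codRestrict (adjoinRoots T α)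
    fun β => deckAlgHom_mem hf hα hT Φ β.2

/-- The homomorphism `ω`. -/
noncomputable def omegaHom (hf : IsWeierstrass f n) (hα : IsRootList q f α)
    (hT : T ≤ (pullback q).range) : deck q →* autGroup T α where
  toFun Φ := AlgEquiv.ofAlgHom (deckRestrict hf hα hT Φ) (deckRestrict hf hα hT Φ⁻¹)
    (by
      ext β y
      change (β : C(E, ℂ)) ((Φ : E ≃ₜ E) ((Φ : E ≃ₜ E).symm y)) = (β : C(E, ℂ)) y
      rw [Homeomorph.apply_symm_apply])
    (by
      ext β y
      change (β : C(E, ℂ)) ((Φ : E ≃ₜ E).symm ((Φ : E ≃ₜ E) y)) = (β : C(E, ℂ)) y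
      rw [Homeomorph.symm_apply_apply])
  map_one' := rfl
  map_mul' _ _ := rfl

theorem omegaHom_apply (hf : IsWeierstrass f n) (hα : IsRootList q f α)
    (hT : T ≤ (pullback q).range) (Φ : deck q) (β : adjoinRoots T α) (y : E) :
    (omegaHom hf hα hT Φ β : C(E, ℂ)) y = (β : C(E, ℂ)) ((Φ : E ≃ₜ E).symm y) := rfl

/-- The `i`-th root as an element of `T[α]`. -/
noncomputable def adjoinedRoot (T : Subring C(E, ℂ)) (α : Fin n → C(E, ℂ)) (i : Fin n) :
    adjoinRoots T α := ⟨α i, Algebra.subset_adjoin ⟨i, rfl⟩⟩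

omit [PathConnectedSpace E] in
theorem autGroup_ext {φ ψ : autGroup T α}
    (h : ∀ i, φ (adjoinedRoot T α i) = ψ (adjoinedRoot T α i)) : φ = ψ := by
  refine AlgEquiv.coe_toAlgHom_injective (AlgHom.adjoin_ext ?_)
  rintro _ ⟨i, rfl⟩
  exact h i

omit [PathConnectedSpace E] in
theorem isFunRoot_autGroup (hα : IsRootList q f α)
    (hcoeff : ∀ i, pullback q (f.coeff i) ∈ T) (φ : autGroup T α) (i : Fin n) :
    IsFunRoot (f.map (pullback q)) (φ (adjoinedRoot T α i) : C(E, ℂ)) := by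
  let F : T[X] := (f.map (pullback q)).toSubring T (by
    intro c hc
    obtain ⟨i, -, rfl⟩ := mem_coeffs_iff.1 (Finset.mem_coe.1 hc)
    rw [coeff_map]
    exact hcoeff i)
  have hF : F.map (algebraMap T C(E, ℂ)) = f.map (pullback q) := map_toSubring _ _ _
  have key (β : adjoinRoots T α) :
      (f.map (pullback q)).eval (β : C(E, ℂ)) = (aeval β F : adjoinRoots T α) := by
    rw [← hF, eval_map_algebraMap]
    exact (Subalgebra.aeval_coe _ β F).symm ▸ rfl
  have h0 : aeval (adjoinedRoot T α i) F = 0 := by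
    refine Subtype.ext ?_
    rw [← key]
    exact isFunRoot_iff.1 (hα.isFunRoot i)
  rw [isFunRoot_iff, key, aeval_algHom_apply, h0, map_zero, ZeroMemClass.coe_zero]

omit [PathConnectedSpace E] in
theorem mem_range_pullback_of_invariant (hq : IsQuotientMap q)
    (htrans : ∀ e e', q e = q e' → ∃ Φ : deck q, (Φ : E ≃ₜ E) e = e') {β : C(E, ℂ)}
    (hβ : ∀ (Φ : deck q) (y : E), β ((Φ : E ≃ₜ E).symm y) = β y) : β ∈ (pullback q).range := by
  have h (e e' : E) (he : q e = q e') : β e = β e' := by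
    obtain ⟨Φ, rfl⟩ := htrans e e' he
    rw [← hβ Φ ((Φ : E ≃ₜ E) e), Homeomorph.symm_apply_apply]
  exact ⟨hq.lift β h, hq.lift_comp β h⟩

theorem mem_of_forall_omegaHom_eq (hf : IsWeierstrass f n) (hα : IsRootList q f α)
    (hT : T ≤ (pullback q).range) (hinv : (adjoinRoots T α : Set C(E, ℂ)) ∩ (pullback q).range = T)
    (hq : IsQuotientMap q)
    (htrans : ∀ e e', q e = q e' → ∃ Φ : deck q, (Φ : E ≃ₜ E) e = e') {β : adjoinRoots T α}
    (hβ : ∀ Φ : deck q, omegaHom hf hα hT Φ β = β) : ∃ t : T, algebraMap T _ t = β := by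
  have h1 : (β : C(E, ℂ)) ∈ (pullback q).range := mem_range_pullback_of_invariant hq htrans
    fun Φ y => by rw [← omegaHom_apply hf hα hT, hβ]
  exact ⟨⟨β, hinv.le ⟨β.2, h1⟩⟩, rfl⟩

/-- For surjectivity, evaluation at `e`, before and after φ, agrees on the invariants of the image
of ω, which lie in `T`. So some Φ has the same effect as φ on all root values at `e`, and rigidity
of root functions gives equality. -/
theorem omegaHom_bijective [T2Space X] [PathConnectedSpace X] [LocallyPathConnectedSpace X]
    (hf : IsWeierstrass f n) (hq : IsSplittingCovering q f n) (hα : IsRootList q f α)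
    (hT : T ≤ (pullback q).range) (hcoeff : ∀ i, pullback q (f.coeff i) ∈ T)
    (hinv : (adjoinRoots T α : Set C(E, ℂ)) ∩ (pullback q).range = T) :
    Function.Bijective (omegaHom hf hα hT) := by
  obtain ⟨e⟩ := (inferInstance : Nonempty E)
  have hqq : IsQuotientMap q := hq.isCoveringMap.isQuotientMap hq.isCoveringMap.surjective
  constructor
  · rw [injective_iff_map_eq_one]
    intro Φ hΦ
    have h1 : Φ⁻¹ = 1 := by
      refine deck_ext hq.isCoveringMap e (hq.eq_of_roots_eq hf hα (apply_deck Φ⁻¹ e) fun i => ?_)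
      have := omegaHom_apply hf hα hT Φ (adjoinedRoot T α i) e
      rw [hΦ] at this
      exact this.symm
    exact inv_eq_one.1 h1
  · intro φ
    have := finite_deck hq.isCoveringMap (hq.finite_fiber hf)
    let D := (omegaHom hf hα hT).range
    have : Finite D := Finite.of_surjective _ (omegaHom hf hα hT).rangeRestrict_surjective
    let a : adjoinRoots T α →+* ℂ :=
      (ContinuousMap.evalAlgHom ℂ ℂ e : C(E, ℂ) →ₐ[ℂ] ℂ).toRingHom.comp
        (adjoinRoots T α).val.toRingHom
    have hab (s : adjoinRoots T α) (hs : ∀ g : D, g • s = s) :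
        a s = a.comp (φ : adjoinRoots T α →+* adjoinRoots T α) s := by
      obtain ⟨t, rfl⟩ := mem_of_forall_omegaHom_eq hf hα hT hinv hqq
        (fun _ _ h => hq.exists_deck hf h) fun Φ => hs ⟨_, Φ, rfl⟩
      simp
    obtain ⟨⟨_, Φ, rfl⟩, hΦ⟩ := exists_forall_eq_of_eq_on_invariants hab (adjoinedRoot T α)
    refine ⟨Φ, autGroup_ext fun i => Subtype.ext ?_⟩
    exact hf.eq_of_apply_eq (isFunRoot_deckAlgHom hα hT Φ i) (isFunRoot_autGroup hα hcoeff φ i)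
      (hΦ i).symm

end Omega

theorem MulEquiv.relIndex_mapSubgroup {G G' : Type*} [Group G] [Group G'] (ω : G ≃* G')
    (H K : Subgroup G) : H.relIndex K = (ω.mapSubgroup H).relIndex (ω.mapSubgroup K) :=
  (Subgroup.relIndex_map_map_of_injective (f := ω.toMonoidHom) H K ω.injective).symm

/-! ### The Galois hypotheses for `T[α]` -/

section Galois

variable {X E : Type u} [TopologicalSpace X] [TopologicalSpace E] [PathConnectedSpace E]
  {f : C(X, ℂ)[X]} {n : ℕ} {q : C(E, X)} {α : Fin n → C(E, ℂ)} {T : Subring C(E, ℂ)}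

/-- `T[α]` has no nontrivial idempotents. -/
theorem adjoinRoots_eq_zero_or_one (β : adjoinRoots T α) (h : β * β = β) : β = 0 ∨ β = 1 := by
  have h1 (y : E) : (β : C(E, ℂ)) y = 0 ∨ (β : C(E, ℂ)) y = 1 := by
    have : (β : C(E, ℂ)) y * (β : C(E, ℂ)) y = (β : C(E, ℂ)) y :=
      congrArg (fun γ : adjoinRoots T α => (γ : C(E, ℂ)) y) h
    grind
  have hclopen : IsClopen ((β : C(E, ℂ)) ⁻¹' {0}) := by
    refine ⟨isClosed_singleton.preimage (β : C(E, ℂ)).continuous, ?_⟩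
    have : (β : C(E, ℂ)) ⁻¹' {0} = (β : C(E, ℂ)) ⁻¹' {1}ᶜ := by
      ext y
      rcases h1 y with h | h <;> simp [h]
    rw [this]
    exact isOpen_compl_singleton.preimage (β : C(E, ℂ)).continuous
  rcases isClopen_iff.1 hclopen with h0 | h0
  · refine Or.inr (Subtype.ext (ContinuousMap.ext fun y => (h1 y).resolve_left fun hy => ?_))
    exact h0.le hy
  · exact Or.inl (Subtype.ext (ContinuousMap.ext fun y => h0.ge (Set.mem_univ y)))

/-- If `Δ` is invertible in `T[α]`, then `T[α]` has Galois coordinates over `T`. -/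
theorem exists_isGaloisCoordinates_adjoinRoots [Finite (autGroup T α)] (hf : IsWeierstrass f n)
    (hα : IsRootList q f α) (hcoeff : ∀ i, pullback q (f.coeff i) ∈ T)
    (hΔ : ∃ δ ∈ adjoinRoots T α, Delta α * δ = 1) :
    ∃ B : Finset (adjoinRoots T α × adjoinRoots T α), IsGaloisCoordinates (autGroup T α) B := by
  have hunit : IsUnit (Delta (adjoinedRoot T α)) := by
    obtain ⟨δ, hδ, h⟩ := hΔ
    refine IsUnit.of_mul_eq_one ⟨δ, hδ⟩ (Subtype.ext ?_)
    have h1 : ((Delta (adjoinedRoot T α) : adjoinRoots T α) : C(E, ℂ)) = Delta α :=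
      map_Delta (adjoinRoots T α).val.toRingHom (adjoinedRoot T α)
    rw [Subalgebra.coe_mul, h1]
    exact h
  refine exists_isGaloisCoordinates fun g hg => ?_
  have hex : ∃ i, g (adjoinedRoot T α i) ≠ adjoinedRoot T α i := by
    by_contra! h
    exact hg (autGroup_ext h)
  obtain ⟨i, hi⟩ := hex
  -- An automorphism permutes the root functions, so the moved root goes to another listed root and
  -- their difference is a unit.
  obtain ⟨j, hj⟩ := hα.exists_eq hf (isFunRoot_autGroup hα hcoeff g i)
  have hgj : g (adjoinedRoot T α i) = adjoinedRoot T α j := Subtype.ext hj.symm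
  refine ⟨adjoinedRoot T α i, ?_⟩
  rw [AlgEquiv.smul_def, hgj]
  exact isUnit_sub_of_isUnit_Delta hunit fun hij => hi (by rw [hgj, hij])

end Galois

/-! ### Assembly of the correspondences -/

theorem mainTheorem1 {X E : Type u} [TopologicalSpace X] [TopologicalSpace E]
    [T2Space X] [PathConnectedSpace X] [LocallyPathConnectedSpace X]
    (hX : SemilocallySimplyConnected X)
    {n : ℕ} (f : Polynomial C(X, ℂ)) (hf : IsWeierstrass f n)
    (q : C(E, X)) (hq : IsSplittingCovering q f n) (e₀ : E)
    (α : Fin n → C(E, ℂ)) (hα : IsRootList q f α) :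
    (∀ T : Subring C(E, ℂ), T ≤ (pullback q).range →
      (∀ i, pullback q (f.coeff i) ∈ T) →
      (adjoinRoots T α : Set C(E, ℂ)) ∩ (pullback q).range = T →
      (∃ δ ∈ adjoinRoots T α, Delta α * δ = 1) →
      -- the isomorphism `ω`
      ∃ ω : deck q ≃* autGroup T α, IsOmega q T α ω ∧
      -- intermediate coverings and subgroups of `A(E/X)`
      ∃ κ : Quotient (IntermediateCovering.isoSetoid q e₀) ≃ Subgroup (deck q),
        (∀ L : IntermediateCovering q e₀, κ (Quotient.mk _ L) = L.deckOver) ∧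
        (∀ L M : IntermediateCovering q e₀,
          (∃ s, L.IsCoveringOver M s) ↔ L.deckOver ≤ M.deckOver) ∧
      -- subgroups of `A(E/X)` and subgroups of `G = Aut_T T[α]`
      ∃ ν : Subgroup (deck q) ≃o Subgroup (autGroup T α),
        (∀ H, ν H = H.map ω.toMonoidHom) ∧
      -- subgroups of `G` and separable `T`-subalgebras of `T[α]`
      ∃ fix : Subgroup (autGroup T α) ≃o
          (SepSubalgebra T (adjoinRoots T α))ᵒᵈ,
        (∀ H', (OrderDual.ofDual (fix H')).1 =
          FixedPoints.subalgebra T (adjoinRoots T α) H') ∧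
        (∀ S : SepSubalgebra T (adjoinRoots T α),
          fix.symm (OrderDual.toDual S) =
            fixingSubgroup (autGroup T α) (S.1 : Set (adjoinRoots T α))) ∧
      -- the extreme rows
        (IntermediateCovering.self e₀ hq.pathConnected hq.isCoveringMap).deckOver = ⊥ ∧
        (IntermediateCovering.base e₀ hq.isCoveringMap).deckOver = ⊤ ∧
        (OrderDual.ofDual (fix ⊥)).1 = ⊤ ∧
        (OrderDual.ofDual (fix ⊤)).1 = ⊥ ∧
      -- degrees and indices
        ∀ (L M : IntermediateCovering q e₀) (s : C(L.carrier, M.carrier)),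
          L.IsCoveringOver M s → ∀ m : M.carrier,
            (s ⁻¹' {m}).Finite ∧
            (s ⁻¹' {m}).ncard = L.deckOver.relIndex M.deckOver ∧
            L.deckOver.relIndex M.deckOver = (ν L.deckOver).relIndex (ν M.deckOver)) ∧
    -- the semi-topological Galois group `G_f = Aut_R R[α]`, `R = q* C(X)`
    (∃ ω : deck q ≃* autGroup (pullback q).range α, IsOmega q (pullback q).range α ω) := by
  have := hq.pathConnected
  have hfin := hq.finite_fiber hf
  have htrans : ∀ e e', q e = q e' → ∃ Φ : deck q, (Φ : E ≃ₜ E) e = e' :=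
    fun _ _ h => hq.exists_deck hf h
  have hqq : IsQuotientMap q := hq.isCoveringMap.isQuotientMap hq.isCoveringMap.surjective
  constructor
  · intro T hT hcoeff hinv hΔ
    obtain ⟨ω, hω⟩ : ∃ ω : deck q ≃* autGroup T α, ∀ Φ, ω Φ = omegaHom hf hα hT Φ :=
      ⟨MulEquiv.ofBijective _ (omegaHom_bijective hf hq hα hT hcoeff hinv), fun _ => rfl⟩
    have := finite_deck hq.isCoveringMap hfin
    have : Finite (autGroup T α) := Finite.of_equiv _ ω.toEquiv
    have hinvariant : Algebra.IsInvariant T (adjoinRoots T α) (autGroup T α) :=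
      ⟨fun β hβ => mem_of_forall_omegaHom_eq hf hα hT hinv hqq htrans fun Φ => hω Φ ▸ hβ (ω Φ)⟩
    obtain ⟨B, hB⟩ := exists_isGaloisCoordinates_adjoinRoots hf hα hcoeff hΔ
    have hidem (β : adjoinRoots T α) (h : β * β = β) : β = 0 ∨ β = 1 :=
      adjoinRoots_eq_zero_or_one (T := T) (α := α) β h
    let fix := hB.galoisCorrespondence (T := T) hidem
    refine ⟨ω, fun Φ β y => by rw [hω, omegaHom_apply],
      IntermediateCovering.isoClassEquiv hq.isCoveringMap hfin htrans e₀, fun _ => rfl,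
      IntermediateCovering.exists_isCoveringOver_iff hfin htrans,
      ω.mapSubgroup, fun _ => rfl, fix, fun _ => rfl, fun _ => rfl, ?_, ?_, ?_, ?_, ?_⟩
    · exact (Subgroup.eq_bot_iff_forall _).2 fun Φ hΦ => Subtype.ext (Homeomorph.ext hΦ)
    · exact (Subgroup.eq_top_iff' _).2 fun Φ => Φ.2
    · refine top_unique fun β _ g => ?_
      rw [show g = 1 from Subsingleton.elim _ _, one_smul]
    · refine bot_unique fun β hβ => ?_
      exact Algebra.mem_bot.2 (hinvariant.isInvariant β fun g => hβ ⟨g, Subgroup.mem_top g⟩)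
    · intro L M s hs m
      obtain ⟨h1, h2⟩ := hs.fiber hq.isCoveringMap hfin htrans m
      exact ⟨h1, h2, ω.relIndex_mapSubgroup _ _⟩
  · refine ⟨MulEquiv.ofBijective (omegaHom hf hα le_rfl) (omegaHom_bijective hf hq hα le_rfl
      (fun i => ⟨f.coeff i, rfl⟩) ?_), fun _ _ _ => rfl⟩
    -- For `T = R` the intersection condition is automatic, since `R` lies in `R[α]`.
    refine Set.inter_eq_right.2 fun β hβ => ?_
    exact (adjoinRoots (pullback q).range α).algebraMap_mem ⟨β, hβ⟩
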